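/- There exist a single query program $Q$ and absolute constants $c, C$ such that the following holds. Let $G=(V,E)$ be an undirected graph on $n\ge 2$ vertices with nonnegative edge weights, let every vertex carry one label from a set $L$ of $\ell$ labels, and let $k\ge 1$ be an integer. For $v\in V$ and $\lambda\in L$ let $\mathrm{dist}(v,\lambda)\in[0,\infty]$ be the shortest-path distance from $v$ to the nearest vertex of label $\lambda$ ($\infty$ if there is none in the component of $v$). Then there is a vertex-label distance oracle for $G$, that is, a data structure $M$ stored in words of memory, such that 1. (size) $M$ consists of at most $C\cdot k\cdot n\cdot \ell^{1/k}$ words; 2. (query time and stretch) for every $v\in V$ and $\lambda\in L$, the program $Q$ with access to $M$, given the query $(v,\lambda)$, stops after at most $C\cdot \ell^{1/k}\cdot\log n$ steps and returns a value $\tilde d$ with $$\mathrm{dist}(v,\lambda)\ \le\ \tilde d\ \le\ (2k-1)\cdot \mathrm{dist}(v,\lambda).$$ The model is a word RAM. Each word of $M$ is either an integer of $c\lceil\log_2(n+\ell)\rceil$ bits or the distance in $G$ between two vertices. The program $Q$ does not depend on $G$, the labels, $n$, $\ell$ or $k$. It uses a fixed finite number of registers and may only read $M$. Each of the following costs one step: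 loading a word by its address, an operation $+,-,\times,\mathrm{div},\mathrm{mod}$ on integer words (reduced modulo the word size), copying or adding distances, setting a register to a constant or to $\infty$, the empty instruction, and evaluating a test that compares two integers or two distances. Vertices and labels are numbered from $0$ to $n-1$ and from $0$ to $\ell-1$. -/

import Mathlib

open scoped ENNReal NNReal

/-! Distances in an undirected graph with nonnegative edge weights. -/

/-- The shortest-path distance between `u` and `v` with respect to the edge weights `wt`:
the least total weight of a walk from `u` to `v`, and `∞` if there is no such walk. -/
noncomputable def wdist {V : Type*} (G : SimpleGraph V) (wt : Sym2 V → ℝ≥0) (u v : V) : ℝ≥0∞ :=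
  ⨅ p : G.Walk u v, (((p.edges.map wt).sum : ℝ≥0) : ℝ≥0∞)

/-- The distance from `v` to the nearest vertex of label `a`
(`∞` if no vertex of label `a` can be reached). -/
noncomputable def labelDist {V L : Type*} (G : SimpleGraph V) (wt : Sym2 V → ℝ≥0) (lab : V → L)
    (v : V) (a : L) : ℝ≥0∞ :=
  ⨅ (u : V) (_ : lab u = a), wdist G wt v u

/-! A random access machine with integer words of `w` bits and separate words for distances.
The data structure is a read-only memory; during a query the machine works in its registers. -/

namespace WordRam

/-- The stored data structure: an array of integer words and an array of distance words. -/
structure Memory where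
  ints : List ℕ
  dists : List ℝ≥0∞

/-- The number of words of the data structure. -/
def Memory.size (M : Memory) : ℕ := M.ints.length + M.dists.length

/-- The words of `M` are legitimate for the word length `w` and the weighted graph `(G, wt)`: every
integer word has at most `w` bits, and every distance word holds the distance between two vertices
of the graph (so that no further information can be packed into a real number). -/
def Memory.Fits {V : Type*} (M : Memory) (w : ℕ) (G : SimpleGraph V) (wt : Sym2 V → ℝ≥0) : Prop :=
  (∀ a ∈ M.ints, a < 2 ^ w) ∧ (∀ d ∈ M.dists, ∃ u v : V, d = wdist G wt u v)

/-- Contents of the integer registers and of the distance registers. A program is a finite object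
and so mentions only a fixed finite number of registers. -/
structure State where
  int : ℕ → ℕ
  dst : ℕ → ℝ≥0∞

/-- Write an integer register. -/
def State.setInt (s : State) (x a : ℕ) : State := ⟨Function.update s.int x a, s.dst⟩

/-- Write a distance register. -/
def State.setDst (s : State) (x : ℕ) (d : ℝ≥0∞) : State := ⟨s.int, Function.update s.dst x d⟩

/-- Arithmetic operations on integer words. -/
inductive Arith
  | add
  | sub
  | mul
  | div
  | mod

/-- The values of the operations, before reduction to a word. -/
def Arith.eval : Arith → ℕ → ℕ → ℕ
  | .add, a, b => a + b
  | .sub, a, b => a - b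
  | .mul, a, b => a * b
  | .div, a, b => a / b
  | .mod, a, b => a % b

/-- Elementary instructions; each takes one step. Distances can be loaded, copied and added, but
there is no passage from distances to integers other than by comparing two distances. -/
inductive Instr
  /-- integer register `x` becomes the constant `a` -/
  | const (x a : ℕ)
  /-- integer register `x` becomes the result of an operation on the registers `y` and `z` -/
  | arith (o : Arith) (x y z : ℕ)
  /-- integer register `x` becomes the integer word whose address is in the register `y` -/
  | load (x y : ℕ)
  /-- distance register `x` becomes the distance word whose address is in integer register `y` -/
  | loadDist (x y : ℕ)
  /-- distance register `x` becomes `∞` -/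
  | infDist (x : ℕ)
  /-- distance register `x` becomes a copy of distance register `y` -/
  | copyDist (x y : ℕ)
  /-- distance register `x` becomes the sum of the distance registers `y` and `z` -/
  | addDist (x y z : ℕ)

/-- The effect of an instruction. Integer results are reduced modulo `2 ^ w`; reading outside the
arrays yields `0`, respectively `∞`. -/
noncomputable def Instr.apply (w : ℕ) (M : Memory) (s : State) : Instr → State
  | .const x a => s.setInt x (a % 2 ^ w)
  | .arith o x y z => s.setInt x (o.eval (s.int y) (s.int z) % 2 ^ w)
  | .load x y => s.setInt x (M.ints.getD (s.int y) 0)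
  | .loadDist x y => s.setDst x (M.dists.getD (s.int y) ⊤)
  | .infDist x => s.setDst x ⊤
  | .copyDist x y => s.setDst x (s.dst y)
  | .addDist x y z => s.setDst x (s.dst y + s.dst z)

/-- Tests for branching; each takes one step. -/
inductive Test
  /-- compare two integer registers -/
  | lt (x y : ℕ)
  /-- compare two integer registers for equality -/
  | eq (x y : ℕ)
  /-- compare two distance registers -/
  | ltDist (x y : ℕ)

/-- The outcome of a test. -/
def Test.Holds (s : State) : Test → Prop
  | .lt x y => s.int x < s.int y
  | .eq x y => s.int x = s.int y
  | .ltDist x y => s.dst x < s.dst y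

/-- Programs. -/
inductive Prog
  | skip
  | instr (i : Instr)
  | seq (p q : Prog)
  | ite (b : Test) (p q : Prog)
  | loop (b : Test) (p : Prog)

/-- `Exec w M p s t s'`: on the word length `w` and the memory `M`, the program `p` started in the
state `s` stops in the state `s'` after `t` steps. Every instruction and every evaluation of a test
is one step; `loop b p` runs `p` as long as `b` holds. -/
inductive Exec (w : ℕ) (M : Memory) : Prog → State → ℕ → State → Prop
  | skip (s : State) : Exec w M .skip s 1 s
  | instr (i : Instr) (s : State) : Exec w M (.instr i) s 1 (i.apply w M s)
  | seq {p q : Prog} {s₁ s₂ s₃ : State} {t₁ t₂ : ℕ} :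
      Exec w M p s₁ t₁ s₂ → Exec w M q s₂ t₂ s₃ → Exec w M (.seq p q) s₁ (t₁ + t₂) s₃
  | ite_true {b : Test} {p q : Prog} {s s' : State} {t : ℕ} :
      b.Holds s → Exec w M p s t s' → Exec w M (.ite b p q) s (t + 1) s'
  | ite_false {b : Test} {p q : Prog} {s s' : State} {t : ℕ} :
      ¬ b.Holds s → Exec w M q s t s' → Exec w M (.ite b p q) s (t + 1) s'
  | loop_stop {b : Test} {p : Prog} {s : State} :
      ¬ b.Holds s → Exec w M (.loop b p) s 1 s
  | loop_next {b : Test} {p : Prog} {s₁ s₂ s₃ : State} {t₁ t₂ : ℕ} :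
      b.Holds s₁ → Exec w M p s₁ t₁ s₂ → Exec w M (.loop b p) s₂ t₂ s₃ →
        Exec w M (.loop b p) s₁ (t₁ + t₂ + 1) s₃

/-- The state at the start of the query `(v, a)`: the numbers of the vertex and of the label are in
the integer registers `0` and `1`, all other registers are `0`. -/
def State.query (v a : ℕ) : State where
  int x := if x = 0 then v else if x = 1 then a else 0
  dst _ := 0

/-- On the query `(v, a)` the program `Q` stops after `t` steps, with the answer `d` in the distance
register `0`. -/
def Answers (w : ℕ) (M : Memory) (Q : Prog) (v a t : ℕ) (d : ℝ≥0∞) : Prop :=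
  ∃ s : State, Exec w M Q (State.query v a) t s ∧ s.dst 0 = d

end WordRam

/-! The oracle is of Thorup–Zwick type. Levels `A 0 = V`, `A 1`, …, `A r` with `r + 1 = min k (clog
n)` are obtained by repeatedly sampling with probability `p`, about `ℓ^(-1/k)`. The bunch of `v`
contains, for each `i < r`, the elements of `A i` nearer to `v` than all of `A (i + 1)`, and also
the nearest element of each level up to `r`. For each vertex `v` the oracle stores its bunch with
distances. A dictionary stores the distance from `w` to the label `a` for each pair `(w, a)` such
that `w` lies in the bunch of some vertex of label `a`, or `w ∈ A r` and `a` occurs. A query `(v,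
a)` scans the bunch of `v`, looks up each `(w, a)` and takes the least sum; the triangle inequality
makes this at least the true distance.

Stretch (`exists_bunch_stretch`): let `u` be the nearest vertex of label `a`. Climbing the levels
and exchanging `v` and `u` at each level, one either meets a common bunch element or reaches `A r`,
all of whose elements are in the dictionary for `a`. The detour costs a factor of at most `2r + 1 ≤
2k - 1`.

Size and time (`exists_levels_univ`): the random count of elements nearer than the sample has a
bounded exponential moment with base `1 + p/2`. Over `r` levels the moments multiply, and one
potential, kept below its mean by the method of conditional expectations, controls at once the sum
of the moments and `|A r|`. Each single moment is at most the sum, so every bunch has size `O(log n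
/ p)`; concavity of the logarithm gives average size `O(k / p)`. Capping `r + 1` at `clog n` keeps
the pivots and the factor `2^(r+1)` harmless when `k` is large.

The dictionary is a two-level perfect hash table of linear size (`exists_perfect_hash`), so each
lookup takes constant time. `exists_memory` lays everything out in words, and `queryProg_answers`
verifies the program. -/

/-! ### Shortest-path and vertex-label distances -/

section Distance

variable {V L : Type*} (G : SimpleGraph V) (wt : Sym2 V → ℝ≥0)

theorem wdist_self (u : V) : wdist G wt u u = 0 := by
  refine le_antisymm ?_ zero_le
  exact (iInf_le _ SimpleGraph.Walk.nil).trans (by simp)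

theorem wdist_comm (u v : V) : wdist G wt u v = wdist G wt v u := by
  have h : ∀ x y, wdist G wt x y ≤ wdist G wt y x := fun x y =>
    le_iInf fun p => (iInf_le _ p.reverse).trans (by
      simp [SimpleGraph.Walk.edges_reverse, List.map_reverse, List.sum_reverse])
  exact le_antisymm (h _ _) (h _ _)

theorem wdist_triangle (u v w : V) : wdist G wt u w ≤ wdist G wt u v + wdist G wt v w := by
  unfold wdist
  rw [ENNReal.iInf_add]
  refine le_iInf fun p => ?_
  rw [ENNReal.add_iInf]
  refine le_iInf fun q => (iInf_le _ (p.append q)).trans ?_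
  simp [SimpleGraph.Walk.edges_append]

theorem labelDist_le (lab : V → L) (v u : V) : labelDist G wt lab v (lab u) ≤ wdist G wt v u :=
  iInf₂_le (f := fun (x : V) (_ : lab x = lab u) => wdist G wt v x) u rfl

theorem exists_labelDist_eq [Finite V] (lab : V → L) (v : V) {a : L} (ha : ∃ u, lab u = a) :
    ∃ u, lab u = a ∧ labelDist G wt lab v a = wdist G wt v u := by
  classical
  cases nonempty_fintype V
  have hne : (Finset.univ.filter fun u => lab u = a).Nonempty := by
    obtain ⟨u, hu⟩ := ha
    exact ⟨u, by simp [hu]⟩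
  obtain ⟨u, hu, hmin⟩ := Finset.exists_min_image _ (fun u => wdist G wt v u) hne
  rw [Finset.mem_filter] at hu
  refine ⟨u, hu.2, le_antisymm (iInf₂_le u hu.2) (le_iInf₂ fun x hx => hmin x ?_)⟩
  simp [hx]

theorem labelDist_eq_top (lab : V → L) (v : V) {a : L} (ha : ¬ ∃ u, lab u = a) :
    labelDist G wt lab v a = ⊤ := by
  push Not at ha
  simp [labelDist, ha]

theorem labelDist_triangle (lab : V → L) (v w : V) (a : L) :
    labelDist G wt lab v a ≤ wdist G wt v w + labelDist G wt lab w a := by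
  unfold labelDist
  rw [ENNReal.add_iInf]
  refine le_iInf fun u => ?_
  by_cases h : lab u = a
  · simp only [h, iInf_pos]
    exact (iInf₂_le u h).trans (wdist_triangle G wt v w u)
  · simp [h]

end Distance

/-! ### Bunches, pivots and the stretch bound -/

section Bunches

variable {V : Type*}

open Classical in
/-- The elements of `A` that are nearer to `v` than every element of `S`. -/
noncomputable def nearer (D : V → V → ℝ≥0∞) (v : V) (A S : Finset V) : Finset V :=
  A.filter fun w => ∀ z ∈ S, D v w < D v z

theorem mem_nearer {D : V → V → ℝ≥0∞} {v w : V} {A S : Finset V} :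
    w ∈ nearer D v A S ↔ w ∈ A ∧ ∀ z ∈ S, D v w < D v z := by
  classical
  simp [nearer]

open Classical in
/-- An element of `A` nearest to `v`, or `v` itself if `A` is empty. -/
noncomputable def pivot (D : V → V → ℝ≥0∞) (A : Finset V) (v : V) : V :=
  if h : A.Nonempty then (A.exists_min_image (D v) h).choose else v

theorem pivot_mem (D : V → V → ℝ≥0∞) {A : Finset V} (h : A.Nonempty) (v : V) :
    pivot D A v ∈ A := by
  rw [pivot, dif_pos h]
  exact (A.exists_min_image (D v) h).choose_spec.1

theorem dist_pivot_le (D : V → V → ℝ≥0∞) {A : Finset V} (v : V) {z : V} (hz : z ∈ A) :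
    D v (pivot D A v) ≤ D v z := by
  have h : A.Nonempty := ⟨z, hz⟩
  rw [pivot, dif_pos h]
  exact (A.exists_min_image (D v) h).choose_spec.2 z hz

variable [DecidableEq V]

/-- The bunch of `v` with respect to the levels `A 0, …, A r`. -/
noncomputable def bunch (D : V → V → ℝ≥0∞) (A : ℕ → Finset V) (r : ℕ) (v : V) : Finset V :=
  ((Finset.range r).biUnion fun i => nearer D v (A i) (A (i + 1))) ∪
    (Finset.range (r + 1)).image fun i => pivot D (A i) v

theorem card_bunch_le (D : V → V → ℝ≥0∞) (A : ℕ → Finset V) (r : ℕ) (v : V) :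
    (bunch D A r v).card ≤
      ∑ i ∈ Finset.range r, (nearer D v (A i) (A (i + 1))).card + (r + 1) := by
  refine (Finset.card_union_le _ _).trans (add_le_add Finset.card_biUnion_le ?_)
  exact Finset.card_image_le.trans (by simp)

theorem pivot_mem_bunch (D : V → V → ℝ≥0∞) (A : ℕ → Finset V) {r i : ℕ} (h : i ≤ r) (v : V) :
    pivot D (A i) v ∈ bunch D A r v :=
  Finset.mem_union_right _ (Finset.mem_image_of_mem _ (Finset.mem_range.2 (by omega)))

/-- Induction on the level with `x` and `y` exchanged: the level-`i` pivot `w` of `y` has distance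
at most `(i + 1) * D x y` from `x`. Either `w` is in the bunch of `x`, hence common, or the next
level has an element no farther from `x` than `w`. An empty next level falls under the first case,
so levels need not be nonempty. -/
theorem exists_common_or_pivot_near [Fintype V] (D : V → V → ℝ≥0∞) (hself : ∀ v, D v v = 0)
    (hcomm : ∀ u v, D u v = D v u) (htri : ∀ u v w, D u w ≤ D u v + D v w) (A : ℕ → Finset V)
    (hA : A 0 = Finset.univ) (r i : ℕ) (hi : i ≤ r) (x y : V) :
    ((A i).Nonempty ∧ D x (pivot D (A i) x) ≤ i * D x y) ∨
      ∃ w, w ∈ bunch D A r x ∧ w ∈ bunch D A r y ∧ D x w + D w y ≤ (2 * r + 1 : ℕ) * D x y := by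
  induction i generalizing x y with
  | zero =>
    left
    rw [hA]
    refine ⟨⟨x, Finset.mem_univ x⟩, ?_⟩
    rw [Nat.cast_zero, zero_mul, ← hself x]
    exact dist_pivot_le D x (Finset.mem_univ x)
  | succ i ih =>
    rcases ih (by omega) y x with ⟨hne, hle⟩ | ⟨w, hy, hx, hw⟩
    · set w := pivot D (A i) y with hwdef
      have hxw : D x w ≤ (i + 1 : ℕ) * D x y := by
        calc D x w ≤ D x y + D y w := htri _ _ _
          _ ≤ D x y + i * D x y := by gcongr; rwa [hcomm x y]
          _ = _ := by push_cast; ring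
      by_cases hmem : w ∈ nearer D x (A i) (A (i + 1))
      · right
        refine ⟨w, ?_, pivot_mem_bunch D A (by omega) y, ?_⟩
        · exact Finset.mem_union_left _
            (Finset.mem_biUnion.2 ⟨i, Finset.mem_range.2 (by omega), hmem⟩)
        · calc D x w + D w y ≤ (i + 1 : ℕ) * D x y + i * D x y := by
                rw [hcomm w y]
                refine add_le_add hxw ?_
                rwa [hcomm x y]
            _ = ((2 * i + 1 : ℕ) : ℝ≥0∞) * D x y := by push_cast; ring
            _ ≤ _ := by gcongr; omega
      · left
        rw [mem_nearer] at hmem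
        push Not at hmem
        obtain ⟨z, hz, hzle⟩ := hmem (pivot_mem D hne y)
        exact ⟨⟨z, hz⟩, (dist_pivot_le D x hz).trans (hzle.trans hxw)⟩
    · right
      refine ⟨w, hx, hy, ?_⟩
      rw [hcomm x w, hcomm w y, add_comm, hcomm x y]
      exact hw

theorem exists_bunch_stretch [Fintype V] (D : V → V → ℝ≥0∞) (hself : ∀ v, D v v = 0)
    (hcomm : ∀ u v, D u v = D v u) (htri : ∀ u v w, D u w ≤ D u v + D v w) (A : ℕ → Finset V)
    (hA : A 0 = Finset.univ) (r : ℕ) (x y : V) :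
    ∃ w ∈ bunch D A r x, (w ∈ bunch D A r y ∨ w ∈ A r) ∧
      D x w + D w y ≤ (2 * r + 1 : ℕ) * D x y := by
  rcases exists_common_or_pivot_near D hself hcomm htri A hA r r le_rfl x y with
    ⟨hne, hle⟩ | ⟨w, hx, hy, hw⟩
  -- The climb reached the top: the last pivot of `x` need not be in the bunch of `y`, but it lies
  -- in `A r`.
  · refine ⟨_, pivot_mem_bunch D A le_rfl x, Or.inr (pivot_mem D hne x), ?_⟩
    set w := pivot D (A r) x
    calc D x w + D w y ≤ D x w + (D x w + D x y) := by
          gcongr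
          rw [hcomm x w]
          exact htri _ _ _
      _ ≤ r * D x y + (r * D x y + D x y) := by gcongr
      _ = _ := by push_cast; ring
  · exact ⟨w, hx, Or.inl hy, hw⟩

end Bunches

/-! ### Sampling, exponential moments and derandomization -/

section Sampling

variable {V : Type*}

/-- The expectation of `f S` for a random `S ⊆ A` that contains each element with probability
`p`. -/
noncomputable def sampleMean (p : ℝ) (A : Finset V) (f : Finset V → ℝ) : ℝ :=
  ∑ S ∈ A.powerset, p ^ S.card * (1 - p) ^ (A.card - S.card) * f S

theorem sampleMean_add (p : ℝ) (A : Finset V) (f g : Finset V → ℝ) :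
    sampleMean p A (fun S => f S + g S) = sampleMean p A f + sampleMean p A g := by
  simp [sampleMean, mul_add, Finset.sum_add_distrib]

theorem sampleMean_const_mul (p c : ℝ) (A : Finset V) (f : Finset V → ℝ) :
    sampleMean p A (fun S => c * f S) = c * sampleMean p A f := by
  simp only [sampleMean, Finset.mul_sum]
  exact Finset.sum_congr rfl fun _ _ => by ring

theorem sampleMean_sum {ι : Type*} (p : ℝ) (A : Finset V) (s : Finset ι)
    (f : ι → Finset V → ℝ) :
    sampleMean p A (fun S => ∑ i ∈ s, f i S) = ∑ i ∈ s, sampleMean p A (f i) := by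
  simp only [sampleMean, Finset.mul_sum]
  exact Finset.sum_comm

theorem sampleMean_congr (p : ℝ) {A : Finset V} {f g : Finset V → ℝ}
    (h : ∀ S ⊆ A, f S = g S) : sampleMean p A f = sampleMean p A g :=
  Finset.sum_congr rfl fun S hS => by rw [h S (Finset.mem_powerset.1 hS)]

variable [DecidableEq V]

theorem sampleMean_insert (p : ℝ) {A : Finset V} {a : V} (ha : a ∉ A) (f : Finset V → ℝ) :
    sampleMean p (insert a A) f =
      (1 - p) * sampleMean p A f + p * sampleMean p A fun S => f (insert a S) := by
  unfold sampleMean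
  rw [Finset.sum_powerset_insert ha, Finset.mul_sum, Finset.mul_sum]
  refine congrArg₂ _ (Finset.sum_congr rfl fun S hS => ?_) (Finset.sum_congr rfl fun S hS => ?_)
  · have := Finset.card_le_card (Finset.mem_powerset.1 hS)
    rw [Finset.card_insert_of_notMem ha, Nat.succ_sub this, pow_succ]
    ring
  · have : a ∉ S := fun h => ha (Finset.mem_powerset.1 hS h)
    rw [Finset.card_insert_of_notMem ha, Finset.card_insert_of_notMem this, pow_succ,
      Nat.add_sub_add_right]
    ring

theorem sampleMean_const (p : ℝ) (A : Finset V) (c : ℝ) : sampleMean p A (fun _ => c) = c := by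
  induction A using Finset.induction_on with
  | empty => simp [sampleMean]
  | insert a A ha ih => rw [sampleMean_insert p ha, ih]; ring

theorem sampleMean_card (p : ℝ) (A : Finset V) :
    sampleMean p A (fun S => (S.card : ℝ)) = p * A.card := by
  induction A using Finset.induction_on with
  | empty => simp [sampleMean]
  | insert a A ha ih =>
    have h : sampleMean p A (fun S => ((insert a S).card : ℝ)) =
        sampleMean p A fun S => (S.card : ℝ) + 1 := sampleMean_congr p fun S hS => by
      rw [Finset.card_insert_of_notMem fun h => ha (hS h)]
      push_cast
      ring
    rw [sampleMean_insert p ha, h, sampleMean_add, sampleMean_const, ih,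
      Finset.card_insert_of_notMem ha]
    push_cast
    ring

theorem exists_le_sampleMean {p : ℝ} (hp0 : 0 ≤ p) (hp1 : p ≤ 1) (A : Finset V)
    (f : Finset V → ℝ) : ∃ S ⊆ A, f S ≤ sampleMean p A f := by
  obtain ⟨S, hS, hmin⟩ := Finset.exists_min_image A.powerset f ⟨∅, by simp⟩
  refine ⟨S, Finset.mem_powerset.1 hS, ?_⟩
  rw [← sampleMean_const p A (f S)]
  refine Finset.sum_le_sum fun T hT => mul_le_mul_of_nonneg_left (hmin T hT) ?_
  have : 0 ≤ 1 - p := by linarith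
  positivity

/-- The empty sample has weight `(1 - p) ^ A.card`; it alone may violate `f ≤ g`, and its excess is
charged separately. -/
theorem sampleMean_mono_except_empty {p : ℝ} (hp0 : 0 ≤ p) (hp1 : p ≤ 1) {A : Finset V}
    {f g : Finset V → ℝ} (h : ∀ S ⊆ A, S.Nonempty → f S ≤ g S) :
    sampleMean p A f ≤ sampleMean p A g + (1 - p) ^ A.card * (f ∅ - g ∅) := by
  have hq : 0 ≤ 1 - p := by linarith
  unfold sampleMean
  rw [← Finset.sum_erase_add _ _ (Finset.empty_mem_powerset A),
    ← Finset.sum_erase_add _ (fun S => p ^ S.card * (1 - p) ^ (A.card - S.card) * g S)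
      (Finset.empty_mem_powerset A)]
  have : ∑ S ∈ A.powerset.erase ∅, p ^ S.card * (1 - p) ^ (A.card - S.card) * f S ≤
      ∑ S ∈ A.powerset.erase ∅, p ^ S.card * (1 - p) ^ (A.card - S.card) * g S := by
    refine Finset.sum_le_sum fun S hS => mul_le_mul_of_nonneg_left ?_ (by positivity)
    rw [Finset.mem_erase, Finset.mem_powerset] at hS
    exact h S hS.2 (Finset.nonempty_iff_ne_empty.2 hS.1)
  simp only [Finset.card_empty, pow_zero, Nat.sub_zero, one_mul]
  linarith

/-- Elements are added in order of increasing distance from `v`. A new farthest element `a` can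
raise the count only if the sample is empty so far and `a` is not sampled. This yields one term of a
geometric series. -/
theorem sampleMean_pow_card_nearer_le_sum {p x : ℝ} (hp0 : 0 ≤ p) (hp1 : p ≤ 1) (hx : 1 ≤ x)
    (D : V → V → ℝ≥0∞) (v : V) (A : Finset V) :
    sampleMean p A (fun S => x ^ (nearer D v A S).card) ≤
      1 + (x - 1) * (1 - p) * ∑ j ∈ Finset.range A.card, ((1 - p) * x) ^ j := by
  have hq : 0 ≤ 1 - p := by linarith
  have hx0 : 0 ≤ x := by linarith
  induction A using Finset.induction_on_max_value (D v) with
  | empty => simp [sampleMean, nearer]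
  | insert a A ha hmax ih =>
    have hmem : ∀ T : Finset V, T.Nonempty → T ⊆ A →
        nearer D v (insert a A) T = nearer D v A T := by
      intro T hT hTA
      obtain ⟨z, hz⟩ := hT
      ext w
      simp only [mem_nearer, Finset.mem_insert]
      constructor
      · rintro ⟨rfl | hw, h⟩
        · exact absurd (h z hz) (not_lt.2 (hmax z (hTA hz)))
        · exact ⟨hw, h⟩
      · rintro ⟨hw, h⟩
        exact ⟨Or.inr hw, h⟩
    have hins : ∀ S ⊆ A, (nearer D v (insert a A) (insert a S)).card ≤ (nearer D v A S).card := by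
      intro S _
      refine Finset.card_le_card fun w hw => ?_
      rw [mem_nearer] at hw ⊢
      obtain ⟨hw, h⟩ := hw
      refine ⟨(Finset.mem_insert.1 hw).resolve_left ?_, fun z hz => h z (by simp [hz])⟩
      rintro rfl
      exact lt_irrefl _ (h w (by simp))
    have h0 : (nearer D v A ∅).card = A.card := by simp [nearer]
    have h1 : (nearer D v (insert a A) ∅).card = A.card + 1 := by
      simp [nearer, Finset.card_insert_of_notMem ha]
    have e1 : sampleMean p A (fun S => x ^ (nearer D v (insert a A) S).card) ≤
        sampleMean p A (fun S => x ^ (nearer D v A S).card) +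
          (1 - p) ^ A.card * (x ^ (A.card + 1) - x ^ A.card) := by
      have := sampleMean_mono_except_empty hp0 hp1 (A := A)
        (f := fun S => x ^ (nearer D v (insert a A) S).card)
        (g := fun S => x ^ (nearer D v A S).card)
        fun S hS hne => by rw [hmem S hne hS]
      simpa only [h0, h1] using this
    have e2 : sampleMean p A (fun S => x ^ (nearer D v (insert a A) (insert a S)).card) ≤
        sampleMean p A (fun S => x ^ (nearer D v A S).card) :=
      Finset.sum_le_sum fun S hS => mul_le_mul_of_nonneg_left
        (pow_le_pow_right₀ hx (hins S (Finset.mem_powerset.1 hS))) (by positivity)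
    rw [sampleMean_insert p ha, Finset.card_insert_of_notMem ha, Finset.sum_range_succ, mul_pow]
    calc _ ≤ (1 - p) * (sampleMean p A (fun S => x ^ (nearer D v A S).card) +
              (1 - p) ^ A.card * (x ^ (A.card + 1) - x ^ A.card)) +
            p * sampleMean p A (fun S => x ^ (nearer D v A S).card) := by gcongr
      _ = sampleMean p A (fun S => x ^ (nearer D v A S).card) +
          (x - 1) * (1 - p) * ((1 - p) ^ A.card * x ^ A.card) := by ring
      _ ≤ _ := by linarith

theorem sampleMean_pow_card_nearer_le {p : ℝ} (hp0 : 0 < p) (hp1 : p ≤ 1)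
    (D : V → V → ℝ≥0∞) (v : V) (A : Finset V) :
    sampleMean p A (fun S => (1 + p / 2) ^ (nearer D v A S).card) ≤ 2 := by
  refine (sampleMean_pow_card_nearer_le_sum hp0.le hp1 (by linarith) D v A).trans ?_
  set y := (1 - p) * (1 + p / 2) with hy
  have hy0 : 0 ≤ y := mul_nonneg (by linarith) (by linarith)
  have hgeom : (∑ j ∈ Finset.range A.card, y ^ j) * (1 - y) ≤ 1 := by
    have := geom_sum_mul_neg y A.card
    rw [this]
    linarith [pow_nonneg hy0 A.card]
  have hsum : 0 ≤ ∑ j ∈ Finset.range A.card, y ^ j :=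
    Finset.sum_nonneg fun _ _ => pow_nonneg hy0 _
  -- Here `1 - y = p / 2 + p ^ 2 / 2`, so the base `1 + p / 2` is small enough for the geometric
  -- series to stay below its prefactor's inverse.
  have hy1 : p / 2 * (1 - p) ≤ 1 - y := by rw [hy]; nlinarith [sq_nonneg p]
  nlinarith [mul_le_mul_of_nonneg_left hy1 hsum]

/-- Repeated sampling, derandomized: the exponential moments of the numbers of nearer elements
and the size of the last level are bounded by their expectations. -/
theorem exists_levels [Fintype V] {p : ℝ} (hp0 : 0 < p) (hp1 : p ≤ 1) (D : V → V → ℝ≥0∞)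
    (r : ℕ) (A₀ : Finset V) (c : V → ℝ) (hc : ∀ v, 0 ≤ c v) (b : ℝ) :
    ∃ A : ℕ → Finset V, A 0 = A₀ ∧
      ∑ v, c v * (1 + p / 2) ^ (∑ i ∈ Finset.range r, (nearer D v (A i) (A (i + 1))).card) +
        b * (A r).card ≤ 2 ^ r * ∑ v, c v + b * (p ^ r * A₀.card) := by
  induction r generalizing A₀ c with
  | zero => exact ⟨fun _ => A₀, rfl, by simp⟩
  | succ r ih =>
    obtain ⟨S, hSA, hS⟩ := exists_le_sampleMean hp0.le hp1 A₀ fun S =>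
      2 ^ r * ∑ v, c v * (1 + p / 2) ^ (nearer D v A₀ S).card + b * p ^ r * S.card
    rw [sampleMean_add, sampleMean_const_mul, sampleMean_const_mul, sampleMean_sum,
      sampleMean_card] at hS
    simp only [sampleMean_const_mul] at hS
    -- The factor earned at the first level is absorbed into the weights of the remaining levels;
    -- this is why arbitrary weights `c` are allowed.
    obtain ⟨A, hA0, hA⟩ := ih S (fun v => c v * (1 + p / 2) ^ (nearer D v A₀ S).card)
      fun v => mul_nonneg (hc v) (by positivity)
    refine ⟨fun i => if i = 0 then A₀ else A (i - 1), by simp, ?_⟩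
    have hsum : ∑ v, c v * sampleMean p A₀ (fun S => (1 + p / 2) ^ (nearer D v A₀ S).card) ≤
        (∑ v, c v) * 2 := by
      rw [Finset.sum_mul]
      exact Finset.sum_le_sum fun v _ =>
        mul_le_mul_of_nonneg_left (sampleMean_pow_card_nearer_le hp0 hp1 D v A₀) (hc v)
    simp only [Finset.sum_range_succ']
    simp only [Nat.add_eq_zero_iff, one_ne_zero, and_false, if_false, if_true,
      Nat.add_sub_cancel, zero_add, hA0, pow_add]
    have e : ∀ v, c v * ((1 + p / 2) ^ (∑ i ∈ Finset.range r, (nearer D v (A i) (A (i + 1))).card) *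
        (1 + p / 2) ^ (nearer D v A₀ S).card) = c v * (1 + p / 2) ^ (nearer D v A₀ S).card *
        (1 + p / 2) ^ (∑ i ∈ Finset.range r, (nearer D v (A i) (A (i + 1))).card) :=
      fun v => by ring
    simp only [e]
    have h2 : (0 : ℝ) ≤ 2 ^ r := by positivity
    have := mul_le_mul_of_nonneg_left hsum h2
    linarith [pow_one p, pow_one (2 : ℝ)]

theorem exists_levels_univ [Fintype V] [Nonempty V] {p : ℝ} (hp0 : 0 < p) (hp1 : p ≤ 1)
    (D : V → V → ℝ≥0∞) (r : ℕ) :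
    ∃ A : ℕ → Finset V, A 0 = Finset.univ ∧
      ∑ v, (1 + p / 2) ^ (∑ i ∈ Finset.range r, (nearer D v (A i) (A (i + 1))).card) ≤
        Fintype.card V * 2 ^ (r + 1) ∧
      ((A r).card : ℝ) ≤ 2 * Fintype.card V * p ^ r := by
  have hn : (0 : ℝ) < Fintype.card V := by exact_mod_cast Fintype.card_pos
  have hpr : 0 < p ^ r := by positivity
  -- The weights `p ^ r` and `2 ^ r` make both parts of the expected potential equal to `(2 * p) ^ r
  -- * n`. Dropping either nonnegative part then bounds the other up to a factor 2.
  obtain ⟨A, hA0, hA⟩ := exists_levels hp0 hp1 D r Finset.univ (fun _ => p ^ r)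
    (fun _ => hpr.le) (2 ^ r)
  refine ⟨A, hA0, ?_⟩
  rw [← Finset.mul_sum] at hA
  simp only [Finset.sum_const, Finset.card_univ, nsmul_eq_mul] at hA
  set s := ∑ v, (1 + p / 2) ^ (∑ i ∈ Finset.range r, (nearer D v (A i) (A (i + 1))).card)
  have hs : 0 ≤ s := Finset.sum_nonneg fun _ _ => by positivity
  have h2 : (0 : ℝ) < 2 ^ r := by positivity
  constructor
  · refine le_of_mul_le_mul_left ?_ hpr
    have : 0 ≤ 2 ^ r * ((A r).card : ℝ) := by positivity
    rw [pow_succ]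
    linarith
  · refine le_of_mul_le_mul_left ?_ h2
    have : 0 ≤ p ^ r * s := by positivity
    linarith

theorem div_three_le_log {p : ℝ} (hp0 : 0 < p) (hp1 : p ≤ 1) : p / 3 ≤ Real.log (1 + p / 2) := by
  have h := Real.one_sub_inv_le_log_of_pos (show 0 < 1 + p / 2 by linarith)
  refine le_trans ?_ h
  rw [le_sub_iff_add_le, ← le_sub_iff_add_le', inv_le_comm₀ (by linarith) (by linarith),
    inv_le_iff_one_le_mul₀ (by linarith)]
  nlinarith

theorem mul_le_log_of_pow_le {p x : ℝ} (hp0 : 0 < p) (hp1 : p ≤ 1) {N : ℕ}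
    (h : (1 + p / 2) ^ N ≤ x) : p / 3 * N ≤ Real.log x := by
  have hlog := Real.log_le_log (by positivity) h
  rw [Real.log_pow] at hlog
  have := mul_le_mul_of_nonneg_left (div_three_le_log hp0 hp1) (Nat.cast_nonneg (α := ℝ) N)
  linarith

/-- Jensen's inequality for the logarithm, in tangent form: `log z ≤ z - 1` with `z = (1 + p / 2) ^
N i / y`, summed over `i`. -/
theorem sum_le_of_sum_pow_le {ι : Type*} {p y : ℝ} (hp0 : 0 < p) (hp1 : p ≤ 1) (hy : 0 < y)
    (s : Finset ι) (N : ι → ℕ) (h : ∑ i ∈ s, (1 + p / 2) ^ N i ≤ s.card * y) :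
    p / 3 * ∑ i ∈ s, (N i : ℝ) ≤ s.card * Real.log y := by
  have key : ∀ i, p / 3 * N i ≤ Real.log y + ((1 + p / 2) ^ N i / y - 1) := by
    intro i
    have hpos : 0 < (1 + p / 2) ^ N i := by positivity
    have h1 := mul_le_log_of_pow_le hp0 hp1 (le_refl ((1 + p / 2) ^ N i))
    have h2 := Real.log_le_sub_one_of_pos (div_pos hpos hy)
    rw [Real.log_div hpos.ne' hy.ne'] at h2
    linarith
  rw [Finset.mul_sum]
  refine (Finset.sum_le_sum fun i _ => key i).trans ?_
  rw [Finset.sum_add_distrib, Finset.sum_sub_distrib, ← Finset.sum_div]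
  simp only [Finset.sum_const, nsmul_eq_mul, mul_one]
  have := (div_le_iff₀ hy).2 h
  linarith

end Sampling

/-! ### Two-level perfect hashing -/

section Hashing

theorem card_filter_dvd_or_dvd_sub_le (P m : ℕ) :
    ((Finset.Ico 1 P).filter fun z => m ∣ z ∨ m ∣ P - z).card ≤ 2 * ((P - 1) / m) := by
  have h1 : ((Finset.Ico 1 P).filter fun z => m ∣ z).card = (P - 1) / m := by
    rw [← Nat.Ioc_filter_dvd_card_eq_div]
    congr 1
  have h2 : ((Finset.Ico 1 P).filter fun z => m ∣ P - z).card ≤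
      ((Finset.Ico 1 P).filter fun z => m ∣ z).card := by
    refine Finset.card_le_card_of_injOn (fun z => P - z) (fun z hz => ?_) fun x hx y hy h => ?_
    · simp only [Finset.coe_filter, Finset.mem_Ico, Set.mem_ofPred_eq] at hz ⊢
      exact ⟨by omega, hz.2⟩
    · simp only [Finset.coe_filter, Finset.mem_Ico, Set.mem_ofPred_eq] at hx hy h
      omega
  rw [Finset.filter_or]
  exact (Finset.card_union_le _ _).trans
    ((add_le_add h1.le (h2.trans h1.le)).trans (two_mul _).ge)

/-- If `x` and `y` collide, then `z = a * (x - y) % P` satisfies `m ∣ z` or `m ∣ P - z`, according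
to which residue is larger. The map `a ↦ z` is injective because `P` is prime. -/
theorem card_hash_collisions_le {P m x y : ℕ} (hP : P.Prime) (hx : x < P) (hyx : y < x) :
    ((Finset.Ico 1 P).filter fun a => a * x % P % m = a * y % P % m).card ≤
      2 * ((P - 1) / m) := by
  have hcop : Nat.Coprime P (x - y) :=
    (Nat.Prime.coprime_iff_not_dvd hP).2 fun h => by
      have := Nat.le_of_dvd (by omega) h
      omega
  refine le_trans (Finset.card_le_card_of_injOn (fun a => a * (x - y) % P) (fun a ha => ?_)
    fun a ha b hb h => ?_) (card_filter_dvd_or_dvd_sub_le P m)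
  · simp only [Finset.coe_filter, Finset.mem_Ico, Set.mem_ofPred_eq] at ha ⊢
    have hz : a * (x - y) % P ≠ 0 := fun h => by
      have := Nat.le_of_dvd (by omega) (hcop.dvd_of_dvd_mul_right (Nat.dvd_of_mod_eq_zero h))
      omega
    have hlt : ∀ z, z % P < P := fun z => Nat.mod_lt _ hP.pos
    refine ⟨⟨by omega, hlt _⟩, ?_⟩
    have hmul : a * y + a * (x - y) = a * x := by rw [← mul_add]; congr 1; omega
    have hsum : a * y % P + a * (x - y) % P ≡ a * x % P [MOD P] := by
      rw [← hmul]
      exact (Nat.ModEq.add (Nat.mod_modEq _ _) (Nat.mod_modEq _ _)).trans (Nat.mod_modEq _ _).symm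
    rcases le_or_gt (a * y % P) (a * x % P) with hle | hlt'
    · left
      have e : a * (x - y) % P = a * x % P - a * y % P := by
        refine Nat.ModEq.eq_of_lt_of_lt (m := P) ?_ (hlt _) ((Nat.sub_le _ _).trans_lt (hlt _))
        refine Nat.ModEq.add_left_cancel' (a * y % P) ?_
        rwa [Nat.add_sub_cancel' hle]
      rw [e]
      exact (Nat.modEq_iff_dvd' hle).1 ha.2.symm
    · right
      have e : a * (x - y) % P = P - (a * y % P - a * x % P) := by
        have hy' := hlt (a * y)
        refine Nat.ModEq.eq_of_lt_of_lt (m := P) ?_ (hlt _) (by omega)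
        refine Nat.ModEq.add_left_cancel' (a * y % P) ?_
        have : a * y % P + (P - (a * y % P - a * x % P)) = a * x % P + P := by omega
        rw [this]
        exact hsum.trans (by simp [Nat.ModEq])
      have e' : P - a * (x - y) % P = a * y % P - a * x % P := by
        have hy' := hlt (a * y)
        omega
      rw [e']
      exact (Nat.modEq_iff_dvd' hlt'.le).1 ha.2
  · simp only [Finset.coe_filter, Finset.mem_Ico, Set.mem_ofPred_eq] at ha hb h
    exact (Nat.ModEq.cancel_right_of_coprime hcop h).eq_of_lt_of_lt ha.1.2 hb.1.2

/-- The ordered pairs of different elements of `S` that collide under `x ↦ a * x % P % m`. -/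
def collisions (P m a : ℕ) (S : Finset ℕ) : Finset (ℕ × ℕ) :=
  S.offDiag.filter fun q => a * q.1 % P % m = a * q.2 % P % m

theorem exists_few_collisions {P m : ℕ} (hP : P.Prime) (S : Finset ℕ) (hS : ∀ x ∈ S, x < P) :
    ∃ a < P, (collisions P m a S).card * m ≤ 2 * (S.card * S.card - S.card) := by
  have hsum : ∑ a ∈ Finset.Ico 1 P, (collisions P m a S).card * m ≤
      ∑ _a ∈ Finset.Ico 1 P, 2 * (S.card * S.card - S.card) := by
    calc ∑ a ∈ Finset.Ico 1 P, (collisions P m a S).card * m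
        = ∑ q ∈ S.offDiag, ((Finset.Ico 1 P).filter fun a =>
            a * q.1 % P % m = a * q.2 % P % m).card * m := by
          simp only [collisions, Finset.card_filter, ← Finset.sum_mul]
          rw [Finset.sum_comm]
      _ ≤ ∑ q ∈ S.offDiag, 2 * (P - 1) := by
          refine Finset.sum_le_sum fun q hq => ?_
          rw [Finset.mem_offDiag] at hq
          have h : ((Finset.Ico 1 P).filter fun a =>
              a * q.1 % P % m = a * q.2 % P % m).card ≤ 2 * ((P - 1) / m) := by
            rcases lt_or_gt_of_ne hq.2.2 with h | h
            · have := card_hash_collisions_le (m := m) hP (hS _ hq.2.1) h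
              simpa only [eq_comm] using this
            · exact card_hash_collisions_le hP (hS _ hq.1) h
          calc _ ≤ 2 * ((P - 1) / m) * m := Nat.mul_le_mul_right _ h
            _ = 2 * ((P - 1) / m * m) := by ring
            _ ≤ _ := Nat.mul_le_mul_left _ (Nat.div_mul_le_self _ _)
      _ = _ := by
          simp only [Finset.sum_const, Finset.offDiag_card, Nat.card_Ico, smul_eq_mul]
          ring
  obtain ⟨a, ha, h⟩ := Finset.exists_le_of_sum_le
    ⟨1, Finset.mem_Ico.2 ⟨le_rfl, hP.one_lt⟩⟩ hsum
  exact ⟨a, (Finset.mem_Ico.1 ha).2, h⟩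

/-- With quadratically many cells, even one colliding pair would exceed the average bound. -/
theorem exists_injOn_hash {P : ℕ} (hP : P.Prime) (S : Finset ℕ) (hS : ∀ x ∈ S, x < P) :
    ∃ a < P, Set.InjOn (fun x => a * x % P % (2 * S.card ^ 2 + 1)) S := by
  obtain ⟨a, ha, h⟩ := exists_few_collisions (m := 2 * S.card ^ 2 + 1) hP S hS
  refine ⟨a, ha, fun x hx y hy hxy => ?_⟩
  by_contra hne
  have hmem : (x, y) ∈ collisions P (2 * S.card ^ 2 + 1) a S :=
    Finset.mem_filter.2 ⟨Finset.mem_offDiag.2 ⟨hx, hy, hne⟩, hxy⟩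
  have hpos := Finset.card_pos.2 ⟨_, hmem⟩
  have := Nat.mul_le_mul_right (2 * S.card ^ 2 + 1) hpos
  have h2 : S.card * S.card - S.card ≤ S.card ^ 2 := by rw [pow_two]; exact Nat.sub_le _ _
  omega

/-- Both sides count the ordered pairs in a common bucket, the diagonal ones giving `S.card`. -/
theorem sum_sq_card_bucket (P m a : ℕ) (hm : 0 < m) (S : Finset ℕ) :
    ∑ b ∈ Finset.range m, (S.filter fun x => a * x % P % m = b).card ^ 2 =
      (collisions P m a S).card + S.card := by
  have h1 : ((S ×ˢ S).filter fun q => a * q.1 % P % m = a * q.2 % P % m).card =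
      (collisions P m a S).card + S.card := by
    rw [collisions, ← Finset.diag_card S, ← Finset.diag_union_offDiag, Finset.filter_union,
      Finset.card_union_of_disjoint
        (Finset.disjoint_filter_filter (Finset.disjoint_diag_offDiag S)), add_comm]
    congr 2
    refine Finset.filter_true_of_mem fun q hq => ?_
    rw [(Finset.mem_diag.1 hq).2]
  rw [← h1, Finset.card_eq_sum_card_fiberwise (f := fun q => a * q.1 % P % m)
    (t := Finset.range m) fun q _ => by simpa using Nat.mod_lt _ hm]
  refine Finset.sum_congr rfl fun b _ => ?_
  rw [pow_two, ← Finset.card_product]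
  congr 1
  ext q
  simp only [Finset.mem_product, Finset.mem_filter]
  constructor
  · rintro ⟨⟨h1, h2⟩, h3, h4⟩
    exact ⟨⟨⟨h1, h3⟩, h2.trans h4.symm⟩, h2⟩
  · rintro ⟨⟨⟨h1, h3⟩, h2⟩, h4⟩
    exact ⟨⟨h1, h4⟩, h3, h2.symm.trans h4⟩

/-- The parameters of a two-level hash table: the modulus `P`, the multiplier `a` and the number
`m` of buckets of the first level, and the multipliers `α`, sizes `μ` and offsets `o` of the
buckets. -/
structure HashParams where
  P : ℕ
  a : ℕ
  m : ℕ
  α : ℕ → ℕ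
  μ : ℕ → ℕ
  o : ℕ → ℕ

/-- The bucket of a key. -/
def HashParams.bucket (h : HashParams) (x : ℕ) : ℕ := h.a * x % h.P % h.m

/-- The position of a key. -/
def HashParams.slot (h : HashParams) (x : ℕ) : ℕ :=
  h.o (h.bucket x) + h.α (h.bucket x) * x % h.P % h.μ (h.bucket x)

/-- A static dictionary of linear size with constant access time. -/
theorem exists_perfect_hash (base U : ℕ) (hU : 0 < U) (S : Finset ℕ) (hS : ∀ x ∈ S, x < U) :
    ∃ h : HashParams, h.m = S.card + 1 ∧ 0 < h.P ∧ h.P ≤ 2 * U ∧ h.a < h.P ∧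
      (∀ b, h.α b < h.P) ∧ (∀ b, 0 < h.μ b) ∧
      (∀ b, base ≤ h.o b) ∧
      (∀ b < h.m, h.o b + h.μ b ≤ base + 7 * S.card + 1) ∧ Set.InjOn h.slot S := by
  obtain ⟨P, hP, hUP, hP2⟩ := Nat.exists_prime_lt_and_le_two_mul U hU.ne'
  have hSP : ∀ x ∈ S, x < P := fun x hx => (hS x hx).trans hUP
  set m := S.card + 1 with hm
  obtain ⟨a, ha, hcol⟩ := exists_few_collisions (m := m) hP S hSP
  let B : ℕ → Finset ℕ := fun b => S.filter fun x => a * x % P % m = b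
  choose α hα hinj using fun b => exists_injOn_hash hP (B b) fun x hx =>
    hSP x (Finset.mem_filter.1 hx).1
  let μ : ℕ → ℕ := fun b => 2 * (B b).card ^ 2 + 1
  let o : ℕ → ℕ := fun b => base + ∑ i ∈ Finset.range b, μ i
  have ho : ∀ b c, b < c → o b + μ b ≤ o c := fun b c h => by
    rw [add_assoc, ← Finset.sum_range_succ]
    exact Nat.add_le_add_left (Finset.sum_le_sum_of_subset (Finset.range_subset_range.2 h)) _
  -- A bucket with `s` keys gets `2 * s ^ 2 + 1` cells. The squares sum to at most `3 * S.card`, and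
  -- the `S.card + 1` buckets add one cell each.
  have htot : o m ≤ base + 7 * S.card + 1 := by
    have h1 := sum_sq_card_bucket P m a (by omega) S
    have h2 : (collisions P m a S).card ≤ 2 * S.card := by
      refine Nat.le_of_mul_le_mul_right (hcol.trans ?_) (show 0 < m by omega)
      calc 2 * (S.card * S.card - S.card) ≤ 2 * (S.card * S.card) := by omega
        _ ≤ _ := by rw [hm]; nlinarith
    have h3 : o m = base + (2 * ∑ b ∈ Finset.range m, (B b).card ^ 2 + m) := by
      simp only [o, μ, Finset.sum_add_distrib, ← Finset.mul_sum]
      simp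
    rw [h3, h1]
    omega
  refine ⟨⟨P, a, m, α, μ, o⟩, rfl, hP.pos, hP2, ha, hα, fun b => Nat.succ_pos _,
    fun b => Nat.le_add_right _ _, fun b hb => (ho b m hb).trans htot, fun x hx y hy hxy => ?_⟩
  have key : ∀ b x, α b * x % P % μ b < μ b := fun b x => Nat.mod_lt _ (Nat.succ_pos _)
  simp only [HashParams.slot, HashParams.bucket] at hxy
  have hb : a * x % P % m = a * y % P % m := by
    by_contra hne
    rcases lt_or_gt_of_ne hne with h | h
    · have := ho _ _ h
      have := key (a * x % P % m) x
      omega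
    · have := ho _ _ h
      have := key (a * y % P % m) y
      omega
  rw [hb] at hxy
  exact hinj (a * y % P % m) (Finset.mem_coe.2 (Finset.mem_filter.2 ⟨hx, hb⟩))
    (Finset.mem_coe.2 (Finset.mem_filter.2 ⟨hy, rfl⟩)) (Nat.add_left_cancel hxy)

end Hashing

/-! ### The query program and its correctness -/

namespace WordRam

/-- A sequence of instructions. -/
def Prog.block : List Instr → Prog
  | [] => .skip
  | i :: l => .seq (.instr i) (Prog.block l)

theorem exec_block (w : ℕ) (M : Memory) (l : List Instr) (s : State) :
    Exec w M (.block l) s (l.length + 1) (l.foldl (Instr.apply w M) s) := by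
  induction l generalizing s with
  | nil => exact .skip s
  | cons i l ih =>
    have := Exec.seq (.instr i s) (ih (i.apply w M s))
    rwa [add_comm 1] at this

/-- Loading the parameters and the boundaries of the list of the vertex. -/
def initBlock : List Instr :=
  [.const 2 1, .const 3 3, .const 4 0, .load 8 4, .load 9 2, .const 4 2, .load 10 4, .load 11 3,
    .const 4 4, .arith .add 4 4 0, .load 5 4, .arith .add 4 4 2, .load 6 4, .infDist 0]

/-- Computing the key of the current list entry and the address of its bucket. -/
def bucketBlock : List Instr :=
  [.load 7 5, .arith .add 7 7 1, .loadDist 1 5, .arith .mul 4 9 7, .arith .mod 4 4 8,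
    .arith .mod 4 4 10, .arith .mul 4 4 3, .arith .add 4 4 11]

/-- Computing the slot of the key and reading it. -/
def slotBlock : List Instr :=
  [.load 12 4, .arith .add 4 4 2, .load 13 4, .arith .add 4 4 2, .load 4 4, .arith .mul 12 12 7,
    .arith .mod 12 12 8, .arith .mod 12 12 13, .arith .add 4 4 12, .load 12 4, .loadDist 2 4]

/-- Comparing the candidate with the least distance so far. -/
def compareProg : Prog :=
  .ite (.eq 12 7)
    (.seq (.instr (.addDist 1 1 2)) (.ite (.ltDist 1 0) (.instr (.copyDist 0 1)) .skip)) .skip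

/-- Treating one list entry. -/
def entryProg : Prog :=
  .seq (.block bucketBlock) (.seq (.block slotBlock)
    (.seq compareProg (.instr (.arith .add 5 5 2))))

/-- The query program. -/
def queryProg : Prog :=
  .seq (.block initBlock) (.loop (.lt 5 6) entryProg)

/-- The integer word at an address. -/
def Memory.intAt (M : Memory) (i : ℕ) : ℕ := M.ints.getD i 0

/-- The distance word at an address. -/
noncomputable def Memory.distAt (M : Memory) (i : ℕ) : ℝ≥0∞ := M.dists.getD i ⊤

/-- The candidate distance that is obtained from the list entry at the address `j`. -/
noncomputable def Memory.candidate (M : Memory) (h : HashParams) (a j : ℕ) : ℝ≥0∞ :=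
  if M.intAt (h.slot (M.intAt j + a)) = M.intAt j + a then
    M.distAt j + M.distAt (h.slot (M.intAt j + a)) else ⊤

/-- The hash table with parameters `h` is stored in `M`, with the parameters of the buckets from
the address `H` on. -/
structure Memory.HasTable (M : Memory) (w : ℕ) (h : HashParams) (H : ℕ) : Prop where
  modulus : M.intAt 0 = h.P
  multiplier : M.intAt 1 = h.a
  buckets : M.intAt 2 = h.m
  base : M.intAt 3 = H
  bucket_multiplier : ∀ b < h.m, M.intAt (H + 3 * b) = h.α b
  bucket_size : ∀ b < h.m, M.intAt (H + 3 * b + 1) = h.μ b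
  bucket_offset : ∀ b < h.m, M.intAt (H + 3 * b + 2) = h.o b
  modulus_pos : 0 < h.P
  modulus_lt : h.P < 2 ^ w
  buckets_pos : 0 < h.m
  base_lt : H + 3 * h.m < 2 ^ w
  size_pos : ∀ b < h.m, 0 < h.μ b
  slot_lt : ∀ b < h.m, h.o b + h.μ b ≤ 2 ^ w

/-- The registers during the loop of the query program. -/
structure LoopState (h : HashParams) (H a j e : ℕ) (s : State) : Prop where
  label : s.int 1 = a
  one : s.int 2 = 1
  three : s.int 3 = 3
  current : s.int 5 = j
  last : s.int 6 = e
  modulus : s.int 8 = h.P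
  multiplier : s.int 9 = h.a
  buckets : s.int 10 = h.m
  base : s.int 11 = H

/-- The hypotheses keep every intermediate value below `2 ^ w`, so no reduction takes effect. -/
theorem bucketBlock_spec {w : ℕ} {M : Memory} {h : HashParams} {H a j e : ℕ} {s : State}
    (hM : M.HasTable w h H) (hs : LoopState h H a j e s) (hkey : M.intAt j + a < 2 ^ w)
    (hmul : h.a * (M.intAt j + a) < 2 ^ w) :
    ∃ s', bucketBlock.foldl (Instr.apply w M) s = s' ∧ LoopState h H a j e s' ∧
      s'.int 7 = M.intAt j + a ∧ s'.int 4 = H + 3 * h.bucket (M.intAt j + a) ∧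
      s'.dst 0 = s.dst 0 ∧ s'.dst 1 = M.distAt j := by
  obtain ⟨h1, h2, h3, h5, h6, h8, h9, h10, h11⟩ := hs
  set x := M.intAt j + a with hx
  have hb : h.bucket x < h.m := Nat.mod_lt _ hM.buckets_pos
  have hbase := hM.base_lt
  have e1 : h.a * x % h.P % 2 ^ w = h.a * x % h.P :=
    Nat.mod_eq_of_lt ((Nat.mod_lt _ hM.modulus_pos).trans hM.modulus_lt)
  have e2 : h.a * x % h.P % h.m % 2 ^ w = h.bucket x :=
    Nat.mod_eq_of_lt (lt_of_lt_of_le hb (by omega))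
  have e3 : h.bucket x * 3 % 2 ^ w = h.bucket x * 3 := Nat.mod_eq_of_lt (by omega)
  have e4 : (h.bucket x * 3 + H) % 2 ^ w = H + 3 * h.bucket x := by
    rw [Nat.mod_eq_of_lt (by omega)]
    ring
  have e0 : (M.ints.getD j 0 + a) % 2 ^ w = x := Nat.mod_eq_of_lt hkey
  refine ⟨_, rfl, ⟨?_, ?_, ?_, ?_, ?_, ?_, ?_, ?_, ?_⟩, ?_, ?_, ?_, ?_⟩ <;>
    simp only [bucketBlock, List.foldl, Instr.apply, State.setInt, State.setDst, Arith.eval,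
      Function.update_apply, reduceIte, Nat.reduceEqDiff,
      OfNat.one_ne_ofNat, h1, h2, h3, h5, h6, h8, h9, h10, h11, e0, Nat.mod_eq_of_lt hmul,
      e1, e2, e3, e4, zero_ne_one, Memory.distAt]

theorem slotBlock_spec {w : ℕ} {M : Memory} {h : HashParams} {H a j e x : ℕ} {s : State}
    (hM : M.HasTable w h H) (hs : LoopState h H a j e s)
    (h7 : s.int 7 = x) (h4 : s.int 4 = H + 3 * h.bucket x)
    (hmul : h.α (h.bucket x) * x < 2 ^ w) :
    ∃ s', slotBlock.foldl (Instr.apply w M) s = s' ∧ LoopState h H a j e s' ∧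
      s'.int 7 = x ∧ s'.int 12 = M.intAt (h.slot x) ∧
      s'.dst 0 = s.dst 0 ∧ s'.dst 1 = s.dst 1 ∧ s'.dst 2 = M.distAt (h.slot x) := by
  obtain ⟨h1, h2, h3, h5, h6, h8, h9, h10, h11⟩ := hs
  have hb : h.bucket x < h.m := Nat.mod_lt _ hM.buckets_pos
  have hbase := hM.base_lt
  have hmu := hM.size_pos _ hb
  have hlt := Nat.mod_lt (h.α (h.bucket x) * x % h.P) hmu
  have hsl := hM.slot_lt _ hb
  have l1 : M.ints.getD (H + 3 * h.bucket x) 0 = h.α (h.bucket x) := hM.bucket_multiplier _ hb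
  have l2 : M.ints.getD (H + 3 * h.bucket x + 1) 0 = h.μ (h.bucket x) := hM.bucket_size _ hb
  have l3 : M.ints.getD (H + 3 * h.bucket x + 1 + 1) 0 = h.o (h.bucket x) := hM.bucket_offset _ hb
  have a1 : (H + 3 * h.bucket x + 1) % 2 ^ w = H + 3 * h.bucket x + 1 :=
    Nat.mod_eq_of_lt (by omega)
  have a2 : (H + 3 * h.bucket x + 1 + 1) % 2 ^ w = H + 3 * h.bucket x + 1 + 1 :=
    Nat.mod_eq_of_lt (by omega)
  have e1 : h.α (h.bucket x) * x % h.P % 2 ^ w = h.α (h.bucket x) * x % h.P :=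
    Nat.mod_eq_of_lt ((Nat.mod_lt _ hM.modulus_pos).trans hM.modulus_lt)
  have e2 : h.α (h.bucket x) * x % h.P % h.μ (h.bucket x) % 2 ^ w =
      h.α (h.bucket x) * x % h.P % h.μ (h.bucket x) := Nat.mod_eq_of_lt (by omega)
  have e3 : (h.o (h.bucket x) + h.α (h.bucket x) * x % h.P % h.μ (h.bucket x)) % 2 ^ w =
      h.slot x := Nat.mod_eq_of_lt (by omega)
  refine ⟨_, rfl, ⟨?_, ?_, ?_, ?_, ?_, ?_, ?_, ?_, ?_⟩, ?_, ?_, ?_, ?_, ?_⟩ <;>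
    simp only [slotBlock, List.foldl, Instr.apply, State.setInt, State.setDst, Arith.eval,
      Function.update_apply, reduceIte, Nat.reduceEqDiff,
      OfNat.one_ne_ofNat, OfNat.zero_ne_ofNat, h1, h2, h3, h4, h5, h6, h7, h8, h9, h10, h11, l1, l2,
      l3, a1, a2, Nat.mod_eq_of_lt hmul, e1, e2, e3, Memory.distAt, Memory.intAt]

theorem compareProg_spec (w : ℕ) (M : Memory) (s : State) :
    ∃ t s', Exec w M compareProg s t s' ∧ t ≤ 4 ∧ s'.int = s.int ∧
      s'.dst 0 = min (s.dst 0) (if s.int 12 = s.int 7 then s.dst 1 + s.dst 2 else ⊤) := by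
  by_cases h : s.int 12 = s.int 7
  · by_cases h' : s.dst 1 + s.dst 2 < s.dst 0
    · refine ⟨_, _, .ite_true h (.seq (.instr _ _) (.ite_true ?_ (.instr _ _))), by norm_num, rfl, ?_⟩
      · simpa [Test.Holds, Instr.apply, State.setDst] using h'
      · simp [Instr.apply, State.setDst, h, min_eq_right h'.le]
    · refine ⟨_, _, .ite_true h (.seq (.instr _ _) (.ite_false ?_ (.skip _))), by norm_num, rfl, ?_⟩
      · simpa [Test.Holds, Instr.apply, State.setDst] using h'
      · simp [Instr.apply, State.setDst, h, min_eq_left (not_lt.1 h')]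
  · exact ⟨_, s, .ite_false h (.skip s), by norm_num, rfl, by simp [h]⟩

theorem entryProg_spec {w : ℕ} {M : Memory} {h : HashParams} {H a j e : ℕ} {s : State}
    (hM : M.HasTable w h H) (hs : LoopState h H a j e s) (hj : j + 1 < 2 ^ w)
    (hkey : M.intAt j + a < 2 ^ w) (hmul : h.a * (M.intAt j + a) < 2 ^ w)
    (hmul' : ∀ b < h.m, h.α b * (M.intAt j + a) < 2 ^ w) :
    ∃ t s', Exec w M entryProg s t s' ∧ t ≤ 30 ∧ LoopState h H a (j + 1) e s' ∧
      s'.dst 0 = min (s.dst 0) (M.candidate h a j) := by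
  obtain ⟨s₁, hs₁, i₁, k₁, b₁, d₁, c₁⟩ := bucketBlock_spec hM hs hkey hmul
  obtain ⟨s₂, hs₂, i₂, k₂, b₂, d₂, c₂, f₂⟩ := slotBlock_spec hM i₁ k₁ b₁
    (hmul' _ (Nat.mod_lt _ hM.buckets_pos))
  obtain ⟨t, s₃, he, ht, hint, hd⟩ := compareProg_spec w M s₂
  have x₁ := exec_block w M bucketBlock s
  have x₂ := exec_block w M slotBlock s₁
  rw [hs₁] at x₁
  rw [hs₂] at x₂
  refine ⟨_, _, .seq x₁ (.seq x₂ (.seq he (.instr _ _))), ?_, ?_, ?_⟩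
  · simp only [bucketBlock, slotBlock, List.length_cons, List.length_nil]
    omega
  · obtain ⟨h1, h2, h3, h5, h6, h8, h9, h10, h11⟩ := i₂
    constructor <;>
      simp [Instr.apply, State.setInt, Arith.eval, hint, h1, h2, h3, h5, h6, h8, h9, h10, h11,
        Nat.mod_eq_of_lt hj]
  · simp only [Instr.apply, State.setInt, hd, d₂, d₁, c₂, c₁, b₂, k₂, f₂]
    rfl

/-- Each entry costs at most 30 steps and one loop test, and replaces the current value by its
minimum with the entry's candidate. -/
theorem loop_spec {w : ℕ} {M : Memory} {h : HashParams} {H a e : ℕ}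
    (hM : M.HasTable w h H) (he : e < 2 ^ w) (l : ℕ) {j : ℕ} {s : State} (hl : j + l = e)
    (hs : LoopState h H a j e s)
    (hkey : ∀ i, j ≤ i → i < e → M.intAt i + a < 2 ^ w ∧ h.a * (M.intAt i + a) < 2 ^ w ∧
      ∀ b < h.m, h.α b * (M.intAt i + a) < 2 ^ w) :
    ∃ t s', Exec w M (.loop (.lt 5 6) entryProg) s t s' ∧ t ≤ 31 * l + 1 ∧
      s'.dst 0 = min (s.dst 0) ((Finset.Ico j e).inf (M.candidate h a)) := by
  induction l generalizing j s with
  | zero =>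
    refine ⟨1, s, ?_, le_rfl, ?_⟩
    · constructor
      simp only [Test.Holds, hs.current, hs.last]
      omega
    · rw [Finset.Ico_eq_empty (by omega)]
      simp
  | succ l ih =>
    obtain ⟨hk1, hk2, hk3⟩ := hkey j le_rfl (by omega)
    obtain ⟨t, s', hx, ht, hs', hd⟩ := entryProg_spec hM hs (by omega) hk1 hk2 hk3
    obtain ⟨t', s'', hx', ht', hd'⟩ := ih (by omega) hs' fun i hi => hkey i (by omega)
    refine ⟨_, s'', .loop_next ?_ hx hx', by omega, ?_⟩
    · simp only [Test.Holds, hs.current, hs.last]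
      omega
    · rw [hd', hd, ← Finset.insert_Ico_add_one_left_eq_Ico (show j < e by omega), Finset.inf_insert,
        min_assoc]

theorem queryProg_answers {w : ℕ} {M : Memory} {h : HashParams} {H v a j e : ℕ}
    (hM : M.HasTable w h H) (hv : 4 + v + 1 < 2 ^ w) (hj : M.intAt (4 + v) = j)
    (he : M.intAt (4 + v + 1) = e) (hje : j ≤ e) (helt : e < 2 ^ w)
    (hkey : ∀ i, j ≤ i → i < e → M.intAt i + a < 2 ^ w ∧ h.a * (M.intAt i + a) < 2 ^ w ∧
      ∀ b < h.m, h.α b * (M.intAt i + a) < 2 ^ w) :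
    ∃ t ≤ 31 * (e - j) + 20,
      Answers w M queryProg v a t ((Finset.Ico j e).inf (M.candidate h a)) := by
  have x₁ := exec_block w M initBlock (State.query v a)
  set s := initBlock.foldl (Instr.apply w M) (State.query v a) with hs
  have c1 : 1 % 2 ^ w = 1 := Nat.mod_eq_of_lt (by omega)
  have c2 : 2 % 2 ^ w = 2 := Nat.mod_eq_of_lt (by omega)
  have c3 : 3 % 2 ^ w = 3 := Nat.mod_eq_of_lt (by omega)
  have c4 : 4 % 2 ^ w = 4 := Nat.mod_eq_of_lt (by omega)
  have c5 : (4 + v) % 2 ^ w = 4 + v := Nat.mod_eq_of_lt (by omega)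
  have c6 : (4 + v + 1) % 2 ^ w = 4 + v + 1 := Nat.mod_eq_of_lt (by omega)
  have m0 := hM.modulus
  have m1 := hM.multiplier
  have m2 := hM.buckets
  have m3 := hM.base
  simp only [Memory.intAt] at m0 m1 m2 m3 hj he
  have hls : LoopState h H a j e s := by
    constructor <;>
      simp [hs, initBlock, Instr.apply, State.setInt, State.setDst, Arith.eval, State.query,
        -List.getD_eq_getElem?_getD, c1, c2, c3, c4, c5, c6, m0, m1, m2, m3,
        hj, he]
  have hd : s.dst 0 = ⊤ := by
    simp [hs, initBlock, Instr.apply, State.setInt, State.setDst]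
  obtain ⟨t, s', hx, ht, hd'⟩ := loop_spec hM helt (e - j) (by omega) hls hkey
  refine ⟨_, ?_, s', .seq x₁ hx, ?_⟩
  · simp only [initBlock, List.length_cons, List.length_nil]
    omega
  · rw [hd', hd]
    simp

end WordRam

/-! ### Memory layout -/

theorem Finset.exists_enumeration {α : Type*} [DecidableEq α] [Nonempty α] (s : Finset α) :
    ∃ g : ℕ → α, (Finset.range s.card).image g = s := by
  refine ⟨fun i => if h : i < s.card then s.equivFin.symm ⟨i, h⟩ else Classical.arbitrary α, ?_⟩
  ext x
  simp only [Finset.mem_image, Finset.mem_range]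
  constructor
  · rintro ⟨i, hi, rfl⟩
    simp [hi]
  · intro hx
    exact ⟨s.equivFin ⟨x, hx⟩, (s.equivFin ⟨x, hx⟩).2, by simp⟩

/-- Finite sets stored one after the other in one sequence. -/
theorem Finset.exists_consecutive_enumeration {α : Type*} [DecidableEq α] [Nonempty α]
    (C : ℕ → Finset α) (n : ℕ) :
    ∃ e : ℕ → α, ∀ v < n, (Finset.Ico (∑ u ∈ Finset.range v, (C u).card)
      (∑ u ∈ Finset.range (v + 1), (C u).card)).image e = C v := by
  induction n with
  | zero => exact ⟨fun _ => Classical.arbitrary α, by simp⟩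
  | succ n ih =>
    obtain ⟨e, he⟩ := ih
    obtain ⟨g, hg⟩ := (C n).exists_enumeration
    set b := ∑ u ∈ Finset.range n, (C u).card with hb
    refine ⟨fun t => if t < b then e t else g (t - b), fun v hv => ?_⟩
    rcases Nat.lt_succ_iff_lt_or_eq.1 hv with hv | rfl
    · rw [← he v hv]
      refine Finset.image_congr fun t ht => if_pos ?_
      exact (Finset.mem_Ico.1 ht).2.trans_le
        (Finset.sum_le_sum_of_subset (Finset.range_subset_range.2 hv))
    · rw [Finset.sum_range_succ, ← hb]
      conv_rhs => rw [← hg]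
      ext x
      simp only [Finset.mem_image, Finset.mem_Ico, Finset.mem_range]
      constructor
      · rintro ⟨t, ⟨h1, h2⟩, rfl⟩
        exact ⟨t - b, by omega, by rw [if_neg (by omega)]⟩
      · rintro ⟨i, hi, rfl⟩
        exact ⟨b + i, by omega, by rw [if_neg (by omega), Nat.add_sub_cancel_left]⟩

theorem mul_add_fin_inj {n ℓ : ℕ} {p q : Fin n × Fin ℓ}
    (h : (p.1 : ℕ) * ℓ + p.2 = q.1 * ℓ + q.2) : p = q := by
  have hp := p.2.2
  have hq := q.2.2
  have hpos : 0 < ℓ := by omega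
  have e : ∀ x : Fin n × Fin ℓ, ((x.1 : ℕ) * ℓ + x.2) / ℓ = x.1 ∧
      ((x.1 : ℕ) * ℓ + x.2) % ℓ = x.2 := fun x => by
    rw [mul_comm, Nat.mul_add_div hpos, Nat.mul_add_mod, Nat.div_eq_of_lt x.2.2,
      Nat.mod_eq_of_lt x.2.2]
    simp
  refine Prod.ext (Fin.ext ?_) (Fin.ext ?_)
  · rw [← (e p).1, h, (e q).1]
  · rw [← (e p).2, h, (e q).2]

theorem mul_add_fin_lt {n ℓ : ℕ} (u : Fin n) (a : Fin ℓ) : (u : ℕ) * ℓ + a < n * ℓ := by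
  have := Nat.mul_le_mul_right ℓ (Nat.succ_le_of_lt u.2)
  have := a.2
  rw [Nat.succ_mul] at *
  omega

namespace WordRam

/-- A memory with `N` integer words `f 0, …` and `N` distance words `g 0, …`. -/
noncomputable def Memory.ofFun (N : ℕ) (f : ℕ → ℕ) (g : ℕ → ℝ≥0∞) : Memory :=
  ⟨(List.range N).map f, (List.range N).map g⟩

theorem Memory.size_ofFun (N : ℕ) (f : ℕ → ℕ) (g : ℕ → ℝ≥0∞) :
    (Memory.ofFun N f g).size = 2 * N := by
  simp [Memory.ofFun, Memory.size, two_mul]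

theorem Memory.intAt_ofFun {N : ℕ} (f : ℕ → ℕ) (g : ℕ → ℝ≥0∞) {i : ℕ} (h : i < N) :
    (Memory.ofFun N f g).intAt i = f i := by
  simp [Memory.ofFun, Memory.intAt, h]

theorem Memory.distAt_ofFun {N : ℕ} (f : ℕ → ℕ) (g : ℕ → ℝ≥0∞) {i : ℕ} (h : i < N) :
    (Memory.ofFun N f g).distAt i = g i := by
  simp [Memory.ofFun, Memory.distAt, h]

/-- Lists `C v` with values `D v u`, and a dictionary `T` with values `E u a`, can be stored in
linear space so that the query program combines them. -/
theorem exists_memory {n ℓ : ℕ} (hn : 0 < n) (hℓ : 0 < ℓ) (C : Fin n → Finset (Fin n))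
    (T : Finset (Fin n × Fin ℓ)) (D : Fin n → Fin n → ℝ≥0∞) (E : Fin n → Fin ℓ → ℝ≥0∞) (w : ℕ)
    (hw₁ : 2 * (n * ℓ) ^ 2 < 2 ^ w) (hw₂ : n + 9 + ∑ v, (C v).card + 10 * T.card < 2 ^ w) :
    ∃ M : Memory, M.size = 2 * (n + 9 + ∑ v, (C v).card + 10 * T.card) ∧
      (∀ x ∈ M.ints, x < 2 ^ w) ∧
      (∀ d ∈ M.dists, d = 0 ∨ (∃ v u, d = D v u) ∨ ∃ q ∈ T, d = E q.1 q.2) ∧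
      ∀ (v : Fin n) (a : Fin ℓ), ∃ t ≤ 31 * (C v).card + 20, Answers w M queryProg v a t
        ((C v).inf fun u => if (u, a) ∈ T then D v u + E u a else ⊤) := by
  classical
  have hnℓ : 0 < n * ℓ := Nat.mul_pos hn hℓ
  have hnℓ2 : n * ℓ ≤ (n * ℓ) ^ 2 := Nat.le_self_pow two_ne_zero _
  -- Entries carry their list's owner `v`, so that the distance `D v u` can be read off the entry
  -- alone.
  let C' : ℕ → Finset (Fin n × Fin n) := fun v =>
    if h : v < n then {⟨v, h⟩} ×ˢ C ⟨v, h⟩ else ∅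
  have hC' : ∀ v : Fin n, C' v = {v} ×ˢ C v := fun v => by simp [C']
  have hcard : ∀ v : Fin n, (C' v).card = (C v).card := fun v => by simp [hC']
  have : Nonempty (Fin n × Fin n) := ⟨(⟨0, hn⟩, ⟨0, hn⟩)⟩
  obtain ⟨e, he⟩ := Finset.exists_consecutive_enumeration C' n
  let start : ℕ → ℕ := fun v => ∑ u ∈ Finset.range v, (C' u).card
  have hstart : start n = ∑ v, (C v).card := by
    simp only [start, Finset.sum_range, hcard]
  have hmono : ∀ u v, u ≤ v → start u ≤ start v := fun u v h =>
    Finset.sum_le_sum_of_subset (Finset.range_subset_range.2 h)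
  have hsucc : ∀ v : Fin n, start (v + 1) = start v + (C v).card := fun v => by
    simp only [start, Finset.sum_range_succ, hcard]
  let enc : Fin n × Fin ℓ → ℕ := fun q => (q.1 : ℕ) * ℓ + q.2
  have henc : ∀ q, enc q < n * ℓ := fun q => mul_add_fin_lt q.1 q.2
  set S := T.image enc with hS
  have hScard : S.card = T.card :=
    Finset.card_image_of_injective _ fun p q h => mul_add_fin_inj h
  -- Addresses `0` to `3` hold the table parameters, `4` to `n + 4` the `n + 1` list boundaries. The
  -- lists start at `L`, the bucket parameters (three per bucket) at `H`, the slots at `B`.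
  set L := n + 5 with hL
  set H := L + start n with hH
  set B := H + 3 * (T.card + 1) with hB
  set N := n + 9 + ∑ v, (C v).card + 10 * T.card with hN
  have hBN : B + 7 * T.card + 1 = N := by omega
  obtain ⟨h, hm, hP0, hP, ha, hα, hμ, hob, ho, hinj⟩ :=
    exists_perfect_hash B (n * ℓ) hnℓ S (by
      intro x hx
      obtain ⟨q, _, rfl⟩ := Finset.mem_image.1 hx
      exact henc q)
  rw [hScard] at hm ho
  have hslot : ∀ x, B ≤ h.slot x ∧ h.slot x < N := fun x => by
    have hb : h.bucket x < h.m := Nat.mod_lt _ (by omega)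
    have h1 := ho _ hb
    have h2 := hob (h.bucket x)
    have h3 := Nat.mod_lt (h.α (h.bucket x) * x % h.P) (hμ (h.bucket x))
    simp only [HashParams.slot]
    omega
  -- An unoccupied slot holds `n * ℓ`, which is not the code of any pair, so a lookup there fails.
  let key : ℕ → ℕ := fun i =>
    if hq : ∃ q ∈ T, h.slot (enc q) = i then enc hq.choose else n * ℓ
  let val : ℕ → ℝ≥0∞ := fun i =>
    if hq : ∃ q ∈ T, h.slot (enc q) = i then E hq.choose.1 hq.choose.2 else 0
  have hfound : ∀ q ∈ T, key (h.slot (enc q)) = enc q ∧ val (h.slot (enc q)) = E q.1 q.2 := by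
    intro q hq
    have hex : ∃ q' ∈ T, h.slot (enc q') = h.slot (enc q) := ⟨q, hq, rfl⟩
    have heq : hex.choose = q := mul_add_fin_inj (hinj
      (Finset.mem_coe.2 (Finset.mem_image_of_mem _ hex.choose_spec.1))
      (Finset.mem_coe.2 (Finset.mem_image_of_mem _ hq)) hex.choose_spec.2)
    simp only [key, val, dif_pos hex, heq, and_self]
  have hmissing : ∀ q ∉ T, key (h.slot (enc q)) ≠ enc q := by
    intro q hq hk
    by_cases hex : ∃ q' ∈ T, h.slot (enc q') = h.slot (enc q)
    · simp only [key, dif_pos hex] at hk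
      exact hq (mul_add_fin_inj hk ▸ hex.choose_spec.1)
    · simp only [key, dif_neg hex] at hk
      exact (henc q).ne' hk
  -- A list entry stores `u * ℓ` instead of `u`: adding the label gives the key, and the program
  -- never needs `ℓ`.
  let f : ℕ → ℕ := fun i =>
    if i = 0 then h.P else if i = 1 then h.a else if i = 2 then h.m else if i = 3 then H else
    if i < L then L + start (i - 4) else
    if i < H then (e (i - L)).2 * ℓ else
    if i < B then
      if (i - H) % 3 = 0 then h.α ((i - H) / 3) else
      if (i - H) % 3 = 1 then h.μ ((i - H) / 3) else h.o ((i - H) / 3)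
    else key i
  let g : ℕ → ℝ≥0∞ := fun i =>
    if i < L then 0 else if i < H then D (e (i - L)).1 (e (i - L)).2 else
    if i < B then 0 else val i
  have hPw : h.P < 2 ^ w := by omega
  have hfin : ∀ x : Fin n, (x : ℕ) * ℓ < n * ℓ := fun x => Nat.mul_lt_mul_of_pos_right x.2 hℓ
  have hf : ∀ i, f i < 2 ^ w := by
    intro i
    simp only [f]
    split_ifs with h0 h1 h2 h3 h4 h5 h6 h7 h8
    · exact hPw
    · omega
    · omega
    · omega
    · have := hmono (i - 4) n (by omega)
      omega
    · have := hfin (e (i - L)).2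
      omega
    · exact (hα _).trans hPw
    · have := ho ((i - H) / 3) (by omega)
      omega
    · have := ho ((i - H) / 3) (by omega)
      have := hμ ((i - H) / 3)
      omega
    · simp only [key]
      split_ifs with hq
      · have := henc hq.choose
        omega
      · omega
  have hg : ∀ i, g i = 0 ∨ (∃ v u, g i = D v u) ∨ ∃ q ∈ T, g i = E q.1 q.2 := by
    intro i
    simp only [g]
    split_ifs
    · exact Or.inl rfl
    · exact Or.inr (Or.inl ⟨_, _, rfl⟩)
    · exact Or.inl rfl
    · simp only [val]
      split_ifs with hq
      · exact Or.inr (Or.inr ⟨_, hq.choose_spec.1, rfl⟩)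
      · exact Or.inl rfl
  set M := Memory.ofFun N f g with hM
  have hint : ∀ {i}, i < N → M.intAt i = f i := fun hi => Memory.intAt_ofFun f g hi
  have hdist : ∀ {i}, i < N → M.distAt i = g i := fun hi => Memory.distAt_ofFun f g hi
  refine ⟨M, Memory.size_ofFun N f g, ?_, ?_, fun v a => ?_⟩
  · intro x hx
    obtain ⟨i, _, rfl⟩ := List.mem_map.1 hx
    exact hf i
  · intro x hx
    obtain ⟨i, _, rfl⟩ := List.mem_map.1 hx
    exact hg i
  have htable : M.HasTable w h H := by
    have hbase : ∀ i b, b < h.m → i < 3 → M.intAt (H + 3 * b + i) =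
        if i = 0 then h.α b else if i = 1 then h.μ b else h.o b := by
      intro i b hb hi
      have e1 : (H + 3 * b + i - H) % 3 = i := by omega
      have e2 : (H + 3 * b + i - H) / 3 = b := by omega
      rw [hint (by omega)]
      simp only [f]
      rw [if_neg (by omega), if_neg (by omega), if_neg (by omega), if_neg (by omega),
        if_neg (by omega), if_neg (by omega), if_pos (by omega), e1, e2]
    constructor
    · exact hint (by omega)
    · exact hint (by omega)
    · exact hint (by omega)
    · exact hint (by omega)
    · intro b hb
      simpa using hbase 0 b hb (by norm_num)
    · intro b hb
      simpa using hbase 1 b hb (by norm_num)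
    · intro b hb
      simpa using hbase 2 b hb (by norm_num)
    · exact hP0
    · exact hPw
    · omega
    · omega
    · exact fun b _ => hμ b
    · intro b hb
      have := ho b hb
      omega
  have hstartv : ∀ u ≤ n, M.intAt (4 + u) = L + start u := by
    intro u hu
    rw [hint (by omega)]
    simp only [f]
    rw [if_neg (by omega), if_neg (by omega), if_neg (by omega), if_neg (by omega),
      if_pos (by omega), Nat.add_sub_cancel_left]
  have hv := v.2
  have hsv := hsucc v
  have hsn := hmono (v + 1) n hv
  have hentry : ∀ t, t < start n → M.intAt (L + t) = (e t).2 * ℓ ∧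
      M.distAt (L + t) = D (e t).1 (e t).2 := by
    intro t ht
    rw [hint (by omega), hdist (by omega)]
    simp only [f, g]
    rw [if_neg (by omega), if_neg (by omega), if_neg (by omega), if_neg (by omega),
      if_neg (by omega), if_pos (by omega), if_neg (by omega), if_pos (by omega),
      Nat.add_sub_cancel_left]
    exact ⟨rfl, rfl⟩
  have hcand : ∀ t, t < start n → M.candidate h a (L + t) =
      if ((e t).2, a) ∈ T then D (e t).1 (e t).2 + E (e t).2 a else ⊤ := by
    intro t ht
    obtain ⟨h1, h2⟩ := hentry t ht
    have henc' : ((e t).2 : ℕ) * ℓ + a = enc ((e t).2, a) := rfl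
    have hs := hslot (enc ((e t).2, a))
    have hk : M.intAt (h.slot (enc ((e t).2, a))) = key (h.slot (enc ((e t).2, a))) := by
      rw [hint hs.2]
      simp only [f]
      rw [if_neg (by omega), if_neg (by omega), if_neg (by omega), if_neg (by omega),
        if_neg (by omega), if_neg (by omega), if_neg (by omega)]
    have hd : M.distAt (h.slot (enc ((e t).2, a))) = val (h.slot (enc ((e t).2, a))) := by
      rw [hdist hs.2]
      simp only [g]
      rw [if_neg (by omega), if_neg (by omega), if_neg (by omega)]
    rw [Memory.candidate, h1, h2, henc', hk, hd]
    by_cases hT : ((e t).2, a) ∈ T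
    · rw [if_pos (hfound _ hT).1, if_pos hT, (hfound _ hT).2]
    · rw [if_neg (hmissing _ hT), if_neg hT]
  -- Hash products do not overflow, since `h.P ≤ 2 * (n * ℓ)`.
  have hmul : ∀ c < h.P, ∀ x < n * ℓ, c * x < 2 ^ w := by
    intro c hc x hx
    calc c * x ≤ 2 * (n * ℓ) * (n * ℓ) := Nat.mul_le_mul (by omega) hx.le
      _ = 2 * (n * ℓ) ^ 2 := by ring
      _ < _ := hw₁
  obtain ⟨t, ht, hans⟩ := queryProg_answers (v := v) (a := a) (j := L + start v)
    (e := L + start (v + 1)) htable (by omega) (hstartv v hv.le)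
    (by rw [add_assoc]; exact hstartv (v + 1) hv) (by omega) (by omega) (by
      intro i hi1 hi2
      obtain ⟨t, rfl⟩ := Nat.exists_eq_add_of_le (show L ≤ i by omega)
      rw [(hentry t (by omega)).1]
      have hx := mul_add_fin_lt (e t).2 a
      exact ⟨by omega, hmul _ ha _ hx, fun b _ => hmul _ (hα b) _ hx⟩)
  refine ⟨t, by omega, ?_⟩
  convert hans using 1
  have hio : Finset.Ico (L + start v) (L + start (v + 1)) =
      (Finset.Ico (start v) (start (v + 1))).image fun t => L + t := by
    ext i
    simp only [Finset.mem_image, Finset.mem_Ico]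
    constructor
    · rintro ⟨h1, h2⟩
      exact ⟨i - L, by omega, by omega⟩
    · rintro ⟨t, h1, rfl⟩
      omega
  have hCv : C v = (Finset.Ico (start v) (start (v + 1))).image fun t => (e t).2 := by
    have := he v hv
    rw [hC'] at this
    have hsnd : C v = (({v} : Finset (Fin n)) ×ˢ C v).image Prod.snd := by
      ext u
      simp
    refine hsnd.trans ?_
    rw [← this, Finset.image_image]
    rfl
  have hfst : ∀ t ∈ Finset.Ico (start v) (start (v + 1)), (e t).1 = v := by
    intro t ht
    have hmem : e t ∈ C' v := by
      rw [← he v hv]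
      exact Finset.mem_image_of_mem e ht
    rw [hC', Finset.mem_product] at hmem
    exact Finset.mem_singleton.1 hmem.1
  rw [hio, hCv, Finset.inf_image, Finset.inf_image]
  refine Finset.inf_congr rfl fun t ht => ?_
  simp only [Function.comp]
  rw [hcand t (lt_of_lt_of_le (Finset.mem_Ico.1 ht).2 hsn), hfst t ht]

end WordRam

/-! ### Choice of parameters and assembly -/

/-- For `k ≤ clog n` take `p = ℓ^(-1/k)`. For larger `k` take `p = 1 / 2`: then `clog n - 1`
halvings already bring the number `ℓ' ≤ n` of occurring labels down to at most 2. -/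
theorem exists_sampling_probability {n ℓ ℓ' k : ℕ} (hn : 2 ≤ n) (hℓ : 1 ≤ ℓ) (hk : 1 ≤ k)
    (h₁ : ℓ' ≤ ℓ) (h₂ : ℓ' ≤ n) :
    ∃ p : ℝ, 0 < p ∧ p ≤ 1 ∧ 1 ≤ 2 * (ℓ : ℝ) ^ (1 / (k : ℝ)) * p ∧
      p ^ (min k (Nat.clog 2 n) - 1) * ℓ' ≤ 2 * (ℓ : ℝ) ^ (1 / (k : ℝ)) := by
  have hℓ1 : (1 : ℝ) ≤ ℓ := by exact_mod_cast hℓ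
  have hk0 : (0 : ℝ) < k := by exact_mod_cast hk
  have hX1 : 1 ≤ (ℓ : ℝ) ^ (1 / (k : ℝ)) := Real.one_le_rpow hℓ1 (by positivity)
  set X := (ℓ : ℝ) ^ (1 / (k : ℝ)) with hX
  have hXk : X ^ k = ℓ := by
    rw [hX, ← Real.rpow_natCast, ← Real.rpow_mul (by positivity), one_div_mul_cancel hk0.ne',
      Real.rpow_one]
  have hX0 : 0 < X := by linarith
  rcases le_or_gt k (Nat.clog 2 n) with hle | hlt
  · refine ⟨X⁻¹, by positivity, inv_le_one_of_one_le₀ hX1, ?_, ?_⟩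
    · rw [mul_assoc, mul_inv_cancel₀ hX0.ne']
      norm_num
    · rw [min_eq_left hle]
      have h : (X⁻¹) ^ (k - 1) * ℓ = X := by
        rw [← hXk, inv_pow, inv_mul_eq_iff_eq_mul₀ (by positivity), ← pow_succ,
          Nat.sub_add_cancel hk]
      calc (X⁻¹) ^ (k - 1) * ℓ' ≤ (X⁻¹) ^ (k - 1) * ℓ := by gcongr
        _ = X := h
        _ ≤ _ := by linarith
  · refine ⟨1 / 2, by norm_num, by norm_num, by linarith, ?_⟩
    rw [min_eq_right hlt.le]
    have hpos : 0 < Nat.clog 2 n := Nat.clog_pos (by norm_num) hn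
    have hn2 : (n : ℝ) ≤ 2 ^ Nat.clog 2 n := by
      exact_mod_cast Nat.le_pow_clog (by norm_num) n
    have h : (1 / 2 : ℝ) ^ (Nat.clog 2 n - 1) * 2 ^ Nat.clog 2 n = 2 := by
      obtain ⟨j, hj⟩ := Nat.exists_eq_add_of_lt hpos
      rw [hj]
      simp only [zero_add, Nat.add_sub_cancel, pow_succ, ← mul_assoc]
      rw [← mul_pow]
      norm_num
    calc (1 / 2 : ℝ) ^ (Nat.clog 2 n - 1) * ℓ' ≤
          (1 / 2 : ℝ) ^ (Nat.clog 2 n - 1) * 2 ^ Nat.clog 2 n := by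
            gcongr
            exact le_trans (by exact_mod_cast h₂) hn2
      _ = 2 := h
      _ ≤ _ := by linarith

theorem clog_mul_log_two_le {n : ℕ} (hn : 2 ≤ n) :
    (Nat.clog 2 n : ℝ) * Real.log 2 ≤ 2 * Real.log n := by
  have hpos : 0 < Nat.clog 2 n := Nat.clog_pos (by norm_num) hn
  have h : 2 ^ (Nat.clog 2 n - 1) < n := Nat.pow_pred_clog_lt_self (by norm_num) hn
  have h' : ((2 : ℝ) ^ (Nat.clog 2 n - 1)) ≤ n := by exact_mod_cast h.le
  have hlog := Real.log_le_log (by positivity) h'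
  have h2 : Real.log 2 ≤ Real.log n := Real.log_le_log (by norm_num) (by exact_mod_cast hn)
  rw [Real.log_pow, Nat.cast_sub hpos] at hlog
  push_cast at hlog
  linarith

/-- The pairs of a vertex `w` and a label `a` such that `w` lies in the last level or in the bunch
of a vertex of label `a`. -/
def dictionaryPairs {V L : Type*} [Fintype V] [DecidableEq V] [DecidableEq L] (lab : V → L)
    (C : V → Finset V) (R : Finset V) : Finset (V × L) :=
  Finset.univ.biUnion fun u => (C u ∪ R).image fun w => (w, lab u)

theorem mem_dictionaryPairs {V L : Type*} [Fintype V] [DecidableEq V] [DecidableEq L]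
    {lab : V → L} {C : V → Finset V} {R : Finset V} {q : V × L} :
    q ∈ dictionaryPairs lab C R ↔ ∃ u, lab u = q.2 ∧ (q.1 ∈ C u ∨ q.1 ∈ R) := by
  obtain ⟨w, a⟩ := q
  simp only [dictionaryPairs, Finset.mem_biUnion, Finset.mem_univ, true_and, Finset.mem_image,
    Finset.mem_union, Prod.mk.injEq]
  constructor
  · rintro ⟨u, x, hx, rfl, h⟩
    exact ⟨u, h, hx⟩
  · rintro ⟨u, h, hx⟩
    exact ⟨u, w, hx, rfl, h⟩

/-- An element of `R` contributes one pair per occurring label, not one per vertex. -/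
theorem card_dictionaryPairs_le {V L : Type*} [Fintype V] [DecidableEq V] [DecidableEq L]
    (lab : V → L) (C : V → Finset V) (R : Finset V) :
    (dictionaryPairs lab C R).card ≤
      ∑ u, (C u).card + R.card * (Finset.univ.image lab).card := by
  have hsub : dictionaryPairs lab C R ⊆
      (Finset.univ.biUnion fun u => (C u).image fun w => (w, lab u)) ∪
        R ×ˢ Finset.univ.image lab := by
    intro q hq
    obtain ⟨u, h, hC | hR⟩ := mem_dictionaryPairs.1 hq
    · exact Finset.mem_union_left _ (Finset.mem_biUnion.2
        ⟨u, Finset.mem_univ u, Finset.mem_image.2 ⟨q.1, hC, Prod.ext rfl h⟩⟩)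
    · exact Finset.mem_union_right _ (Finset.mem_product.2
        ⟨hR, Finset.mem_image.2 ⟨u, Finset.mem_univ u, h⟩⟩)
  refine (Finset.card_le_card hsub).trans ((Finset.card_union_le _ _).trans ?_)
  rw [Finset.card_product]
  gcongr
  exact Finset.card_biUnion_le.trans (Finset.sum_le_sum fun u _ => Finset.card_image_le)

/-- The combinatorial part of the oracle: small lists of vertices and a small dictionary of
vertex-label pairs that determine the distances up to the factor `2 * k - 1`. -/
theorem exists_lists_and_dictionary {n ℓ k : ℕ} (G : SimpleGraph (Fin n))
    (wt : Sym2 (Fin n) → ℝ≥0) (lab : Fin n → Fin ℓ) (hn : 2 ≤ n) (hk : 1 ≤ k) :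
    ∃ (C : Fin n → Finset (Fin n)) (T : Finset (Fin n × Fin ℓ)),
      (∀ q ∈ T, ∃ u, lab u = q.2) ∧
      (∀ v, ((C v).card : ℝ) ≤ 22 * (ℓ : ℝ) ^ (1 / (k : ℝ)) * Real.log n) ∧
      (∑ v, ((C v).card : ℝ) ≤ 7 * (k * n * (ℓ : ℝ) ^ (1 / (k : ℝ)))) ∧
      ((T.card : ℝ) ≤ 11 * (k * n * (ℓ : ℝ) ^ (1 / (k : ℝ)))) ∧
      ∀ v u, ∃ w ∈ C v, (w, lab u) ∈ T ∧
        wdist G wt v w + wdist G wt w u ≤ (2 * k - 1 : ℕ) * wdist G wt v u := by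
  have hℓ : 1 ≤ ℓ := (Nat.zero_le _).trans_lt (lab ⟨0, by omega⟩).2
  have hl1 : (Finset.univ.image lab).card ≤ ℓ := (Finset.card_le_univ _).trans (by simp)
  have hl2 : (Finset.univ.image lab).card ≤ n := Finset.card_image_le.trans (by simp)
  obtain ⟨p, hp0, hp1, hpX, hpr⟩ := exists_sampling_probability hn hℓ hk hl1 hl2
  have hX1 : 1 ≤ (ℓ : ℝ) ^ (1 / (k : ℝ)) :=
    Real.one_le_rpow (by exact_mod_cast hℓ) (by positivity)
  set X := (ℓ : ℝ) ^ (1 / (k : ℝ)) with hX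
  have hclog : 0 < Nat.clog 2 n := Nat.clog_pos (by norm_num) hn
  obtain ⟨r, hr⟩ : ∃ r, min k (Nat.clog 2 n) = r + 1 := ⟨min k (Nat.clog 2 n) - 1, by omega⟩
  rw [hr, Nat.add_sub_cancel] at hpr
  have hrk : r + 1 ≤ k := hr ▸ min_le_left _ _
  have hrc : r + 1 ≤ Nat.clog 2 n := hr ▸ min_le_right _ _
  have hrk' : (r : ℝ) + 1 ≤ k := by exact_mod_cast hrk
  have hn0 : (2 : ℝ) ≤ n := by exact_mod_cast hn
  have : Nonempty (Fin n) := ⟨⟨0, by omega⟩⟩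
  obtain ⟨A, hA0, hA, hAr⟩ := exists_levels_univ hp0 hp1 (wdist G wt) r
  rw [Fintype.card_fin] at hA hAr
  set N : Fin n → ℕ := fun v =>
    ∑ i ∈ Finset.range r, (nearer (wdist G wt) v (A i) (A (i + 1))).card with hN
  set C := bunch (wdist G wt) A r with hC
  have hCN : ∀ v, ((C v).card : ℝ) ≤ N v + (r + 1) := fun v => by
    exact_mod_cast card_bunch_le (wdist G wt) A r v
  have hlog2 := Real.log_two_gt_d9
  have hlog2' := Real.log_two_lt_d9
  have hlogn : Real.log 2 ≤ Real.log n := Real.log_le_log (by norm_num) hn0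
  have hrlog : ((r : ℝ) + 1) * Real.log 2 ≤ 2 * Real.log n := by
    refine le_trans ?_ (clog_mul_log_two_le hn)
    gcongr
    exact_mod_cast hrc
  have hr4 : (r : ℝ) + 1 ≤ 4 * Real.log n := by
    have : ((r : ℝ) + 1) * (1 / 2) ≤ (r + 1) * Real.log 2 := by gcongr; linarith
    linarith
  have hlogpow : Real.log (2 ^ (r + 1)) = (r + 1) * Real.log 2 := by
    rw [Real.log_pow]
    push_cast
    rfl
  -- This is the bound `1 / p ≤ 2 * X`, turning logarithmic estimates into estimates of
  -- cardinalities.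
  have hscale : ∀ {x y : ℝ}, 0 ≤ x → p / 3 * x ≤ y → x ≤ 6 * X * y := by
    intro x y hx h
    have h1 : x * 1 ≤ x * (2 * X * p) := mul_le_mul_of_nonneg_left hpX hx
    have h2 := mul_le_mul_of_nonneg_left h (show 0 ≤ 6 * X by linarith)
    linarith
  have hNv : ∀ v, (N v : ℝ) ≤ 18 * X * Real.log n := by
    intro v
    have h1 : (1 + p / 2) ^ N v ≤ n * 2 ^ (r + 1) := le_trans
      (Finset.single_le_sum (f := fun v => (1 + p / 2) ^ N v)
        (fun _ _ => by positivity) (Finset.mem_univ v)) hA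
    have h2 := mul_le_log_of_pow_le hp0 hp1 h1
    rw [Real.log_mul (by positivity) (by positivity), hlogpow] at h2
    have h3 := hscale (Nat.cast_nonneg _) (h2.trans (show _ ≤ 3 * Real.log n by linarith))
    linarith
  have hNsum : ∑ v, (N v : ℝ) ≤ 6 * X * (n * (r + 1)) := by
    have h1 := sum_le_of_sum_pow_le hp0 hp1 (show (0 : ℝ) < 2 ^ (r + 1) by positivity)
      Finset.univ N (by simpa using hA)
    rw [hlogpow, Finset.card_univ, Fintype.card_fin] at h1
    refine hscale (Finset.sum_nonneg fun _ _ => Nat.cast_nonneg _) (h1.trans ?_)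
    gcongr
    nlinarith [Nat.cast_nonneg (α := ℝ) r]
  have hCsum : ∑ v, ((C v).card : ℝ) ≤ 7 * (k * n * X) := by
    calc ∑ v, ((C v).card : ℝ) ≤ ∑ v, ((N v : ℝ) + (r + 1)) := Finset.sum_le_sum fun v _ => hCN v
      _ = ∑ v, (N v : ℝ) + n * (r + 1) := by simp [Finset.sum_add_distrib, mul_add]
      _ ≤ 6 * X * (n * (r + 1)) + X * (n * (r + 1)) := by
          refine add_le_add hNsum ?_
          exact le_mul_of_one_le_left (by positivity) hX1
      _ = 7 * ((r + 1) * n * X) := by ring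
      _ ≤ _ := by gcongr
  have hAl : ((A r).card : ℝ) * (Finset.univ.image lab).card ≤ 4 * (k * n * X) := by
    have hk1 : (1 : ℝ) ≤ k := by exact_mod_cast hk
    calc ((A r).card : ℝ) * (Finset.univ.image lab).card ≤
          2 * n * p ^ r * (Finset.univ.image lab).card := by gcongr
      _ = 2 * n * (p ^ r * (Finset.univ.image lab).card) := by ring
      _ ≤ 2 * n * (2 * X) := by gcongr
      _ = 4 * (1 * n * X) := by ring
      _ ≤ _ := by gcongr
  refine ⟨C, dictionaryPairs lab C (A r), ?_, ?_, hCsum, ?_, ?_⟩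
  · intro q hq
    obtain ⟨u, hu, _⟩ := mem_dictionaryPairs.1 hq
    exact ⟨u, hu⟩
  · intro v
    have h1 := hCN v
    have h2 := hNv v
    have h3 : 1 * (4 * Real.log n) ≤ X * (4 * Real.log n) := by gcongr
    linarith
  · have h := card_dictionaryPairs_le lab C (A r)
    have h' : ((dictionaryPairs lab C (A r)).card : ℝ) ≤
        ∑ u, ((C u).card : ℝ) + (A r).card * (Finset.univ.image lab).card := by exact_mod_cast h
    linarith
  · intro v u
    obtain ⟨w, hw, hwT, hle⟩ := exists_bunch_stretch (wdist G wt) (wdist_self G wt)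
      (wdist_comm G wt) (wdist_triangle G wt) A hA0 r v u
    refine ⟨w, hw, mem_dictionaryPairs.2 ⟨u, rfl, hwT⟩, hle.trans ?_⟩
    gcongr
    omega

/-- Everything is a polynomial of degree at most 4 in `q = n + ℓ ≥ 3`; the fifth power absorbs the
constants. -/
theorem word_length_suffices {n ℓ c t : ℕ} (hn : 2 ≤ n) (hℓ : 1 ≤ ℓ) (hc : c ≤ n * n)
    (ht : t ≤ n * ℓ) :
    2 * (n * ℓ) ^ 2 < 2 ^ (5 * Nat.clog 2 (n + ℓ)) ∧
      n + 9 + c + 10 * t < 2 ^ (5 * Nat.clog 2 (n + ℓ)) := by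
  have hq : (n + ℓ) ^ 5 ≤ 2 ^ (5 * Nat.clog 2 (n + ℓ)) := by
    rw [mul_comm, pow_mul]
    exact Nat.pow_le_pow_left (Nat.le_pow_clog (by norm_num) _) 5
  obtain ⟨q, hqdef⟩ : ∃ q, q = n + ℓ := ⟨_, rfl⟩
  rw [← hqdef] at hq ⊢
  have hq3 : 3 ≤ q := by omega
  have hnℓ : n * ℓ ≤ q ^ 2 := by
    rw [pow_two]
    exact Nat.mul_le_mul (by omega) (by omega)
  have hnn : n * n ≤ q ^ 2 := by
    rw [pow_two]
    exact Nat.mul_le_mul (by omega) (by omega)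
  have h4 : 3 * q ^ 4 ≤ q ^ 5 := by
    calc 3 * q ^ 4 ≤ q * q ^ 4 := Nat.mul_le_mul_right _ hq3
      _ = q ^ 5 := by ring
  have h3 : 27 * q ^ 2 ≤ q ^ 5 := by
    calc 27 * q ^ 2 = 3 ^ 3 * q ^ 2 := by norm_num
      _ ≤ q ^ 3 * q ^ 2 := Nat.mul_le_mul_right _ (Nat.pow_le_pow_left hq3 3)
      _ = q ^ 5 := by ring
  have h2 : 3 * q ≤ q ^ 2 := by
    rw [pow_two]
    exact Nat.mul_le_mul_right _ hq3
  have h1 : (n * ℓ) ^ 2 ≤ q ^ 4 := by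
    calc (n * ℓ) ^ 2 ≤ (q ^ 2) ^ 2 := Nat.pow_le_pow_left hnℓ 2
      _ = q ^ 4 := by ring
  have h0 : 0 < q ^ 4 := by positivity
  constructor
  · omega
  · omega

theorem mainTheorem2 :
    ∃ (Q : WordRam.Prog) (c : ℕ) (C : ℝ),
      ∀ (n ℓ k : ℕ) (G : SimpleGraph (Fin n)) (wt : Sym2 (Fin n) → ℝ≥0) (lab : Fin n → Fin ℓ),
        2 ≤ n → 1 ≤ k →
        ∃ M : WordRam.Memory,
          M.Fits (c * Nat.clog 2 (n + ℓ)) G wt ∧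
          (M.size : ℝ) ≤ C * k * n * (ℓ : ℝ) ^ (1 / (k : ℝ)) ∧
          ∀ (v : Fin n) (a : Fin ℓ), ∃ (t : ℕ) (d : ℝ≥0∞),
            WordRam.Answers (c * Nat.clog 2 (n + ℓ)) M Q v a t d ∧
            (t : ℝ) ≤ C * (ℓ : ℝ) ^ (1 / (k : ℝ)) * Real.log n ∧
            labelDist G wt lab v a ≤ d ∧
            d ≤ ((2 * k - 1 : ℕ) : ℝ≥0∞) * labelDist G wt lab v a := by
  -- `722 = 31 * 22 + 40`: 31 steps per bunch element, at most `22 * X * log n` elements, and the 20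
  -- additional steps cost at most `40 * X * log n` because `log n ≥ 1 / 2`. The size bound needs
  -- less.
  refine ⟨WordRam.queryProg, 5, 722, fun n ℓ k G wt lab hn hk => ?_⟩
  have hℓ : 1 ≤ ℓ := (Nat.zero_le _).trans_lt (lab ⟨0, by omega⟩).2
  obtain ⟨C, T, hT, hC, hCsum, hTcard, hstretch⟩ := exists_lists_and_dictionary G wt lab hn hk
  have hX1 : 1 ≤ (ℓ : ℝ) ^ (1 / (k : ℝ)) :=
    Real.one_le_rpow (by exact_mod_cast hℓ) (by positivity)
  set X := (ℓ : ℝ) ^ (1 / (k : ℝ)) with hX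
  have hn0 : (2 : ℝ) ≤ n := by exact_mod_cast hn
  have hk0 : (1 : ℝ) ≤ k := by exact_mod_cast hk
  have hCnn : ∑ v, (C v).card ≤ n * n :=
    (Finset.sum_le_sum fun v _ => Finset.card_le_univ (C v)).trans (by simp)
  have hTnn : T.card ≤ n * ℓ := (Finset.card_le_univ T).trans (by simp)
  obtain ⟨hw₁, hw₂⟩ := word_length_suffices hn hℓ hCnn hTnn
  obtain ⟨M, hsize, hints, hdists, hans⟩ := WordRam.exists_memory (by omega) hℓ C T
    (wdist G wt) (labelDist G wt lab) _ hw₁ hw₂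
  refine ⟨M, ⟨hints, fun d hd => ?_⟩, ?_, fun v a => ?_⟩
  · rcases hdists d hd with rfl | ⟨v, u, rfl⟩ | ⟨q, hq, rfl⟩
    · exact ⟨⟨0, by omega⟩, ⟨0, by omega⟩, (wdist_self G wt _).symm⟩
    · exact ⟨v, u, rfl⟩
    · obtain ⟨u, _, hu⟩ := exists_labelDist_eq G wt lab q.1 (hT q hq)
      exact ⟨q.1, u, hu⟩
  · rw [hsize]
    push_cast
    have h1 : (n : ℝ) ≤ k * n * X := by
      calc (n : ℝ) = 1 * n * 1 := by ring
        _ ≤ _ := by gcongr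
    linarith
  · obtain ⟨t, ht, hA⟩ := hans v a
    refine ⟨t, _, hA, ?_, ?_, ?_⟩
    · have ht' : (t : ℝ) ≤ 31 * (C v).card + 20 := by exact_mod_cast ht
      have hlog : (1 / 2 : ℝ) ≤ Real.log n := by
        have := Real.log_le_log (by norm_num) hn0
        linarith [Real.log_two_gt_d9]
      have h1 : 1 * (1 / 2 : ℝ) ≤ X * Real.log n := by gcongr
      linarith [hC v]
    · refine Finset.le_inf fun u _ => ?_
      split_ifs
      · exact labelDist_triangle G wt lab v u a
      · exact le_top
    · by_cases ha : ∃ u, lab u = a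
      · obtain ⟨u, rfl, hu⟩ := exists_labelDist_eq G wt lab v ha
        obtain ⟨w, hw, hwT, hle⟩ := hstretch v u
        rw [hu]
        refine (Finset.inf_le hw).trans ?_
        rw [if_pos hwT]
        exact (add_le_add le_rfl (labelDist_le G wt lab w u)).trans hle
      -- For an absent label the right-hand side is `∞`, as `2 * k - 1 ≠ 0`.
      · rw [labelDist_eq_top G wt lab v ha, ENNReal.mul_top]
        · exact le_top
        · exact_mod_cast (show 2 * k - 1 ≠ 0 by omega)
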